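/- Let $\alpha$ be an ordinal. A cylindric algebra of dimension $\alpha$ is a Boolean algebra $A$ with unary operations $\mathsf c_i$ and constants $\mathsf d_{ij}$ $(i,j<\alpha)$ such that $\mathsf c_i0=0$; $x\le \mathsf c_ix$; $\mathsf c_i(x\cdot \mathsf c_iy)=\mathsf c_ix\cdot \mathsf c_iy$; $\mathsf c_i\mathsf c_jx=\mathsf c_j\mathsf c_ix$; $\mathsf d_{ii}=1$; $\mathsf d_{ij}=\mathsf c_k(\mathsf d_{ik}\cdot \mathsf d_{jk})$ if $k\ne i,j$; and $\mathsf c_i(\mathsf d_{ij}\cdot x)\cdot \mathsf c_i(\mathsf d_{ij}\cdot -x)=0$ if $i\neq j$. Put $\Delta p=\{i<\alpha:\mathsf c_ip\ne p\}$, $\mathsf q_ix=-\mathsf c_i{-x}$, $\mathsf s^i_jx=\mathsf c_i(\mathsf d_{ij}\cdot x)$ and $p\leftrightarrow q=(-p+q)\cdot(-q+p)$. The class $\mathsf{TCA}_\alpha$ of topological cylindric algebras of dimension $\alpha$ consists of the cylindric algebras of dimension $\alpha$ with additional unary operations $I_i$ $(i<\alpha)$ such that, for all $p,q\in A$ and $i,j,k<\alpha$: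 $\mathsf q_i(p\leftrightarrow q)\le \mathsf q_i(I_ip\leftrightarrow I_iq)$; $I_ip\le p$; $I_ip\cdot I_iq=I_i(p\cdot q)$; $I_ip\le I_iI_ip$; $I_i1=1$; $\mathsf c_kI_ip=I_ip$ if $k\ne i$ and $k\notin\Delta p$; and $\mathsf s^i_jI_ip=I_j\mathsf s^i_jp$ if $j\notin\Delta p$. For $\alpha\le\beta$ and $B\in\mathsf{TCA}_\beta$, the neat reduct $\mathfrak{Nr}_\alpha B$ is the algebra with universe $\{b\in B:\Delta b\subseteq\alpha\}$ and the operations of $B$ with indices below $\alpha$; $A\in \mathbf S\,\mathsf{Nr}_\alpha\mathsf{TCA}_\beta$ means that $A$ embeds into $\mathfrak{Nr}_\alpha B$ for some $B\in\mathsf{TCA}_\beta$. If $U$ is a topological space and $V\subseteq{}^\alpha U$, the algebra $\wp(V)$ has the Boolean set operations, $\mathsf c_kX=\{s\in V:\exists t\in X\ \forall j\neq k\ t_j=s_j\}$, $\mathsf d_{ij}=\{s\in V:s_i=s_j\}$ and $I_kX=\{s\in V: s_k\in\mathrm{int}\{a\in U: s^k_a\in X\}\}$, where $s^k_a$ agrees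 with $s$ except that its value at $k$ is $a$. For a nonempty set $W$ and $p\in{}^\alpha W$, the weak space ${}^\alpha W^{(p)}$ is the set of those $s\in{}^\alpha W$ that differ from $p$ at only finitely many places. A full topological weak set algebra is $\wp({}^\alpha U^{(p)})$ with $U$ a nonempty topological space. A generalized weak space with base $U$ is a union $V=\bigcup_{i\in I}{}^\alpha U_i^{(p_i)}$ of pairwise disjoint weak spaces (for distinct indices) with nonempty $U_i$ and $\bigcup_iU_i=U$; a topological generalized weak set algebra is a subalgebra of $\wp(V)$ for a generalized weak space $V$ whose base is a topological space. An algebra is representable if it embeds into a direct product of full topological weak set algebras. Theorem. Let $\alpha$ be an ordinal and $A\in\mathsf{TCA}_\alpha$. Then $A$ is representable if and only if $A\in\mathbf S\,\mathsf{Nr}_\alpha\mathsf{TCA}_{\alpha+\omega}$. If $\alpha\ge 2$, then moreover $A$ is isomorphic to a topological generalized weak set algebra if and only if $A\in\mathbf S\,\mathsf{Nr}_\alpha\mathsf{TCA}_{\alpha+\omega}$. -/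

import Mathlib

universe u

/-- The non-Boolean operations of the signature of topological cylindric algebras with index set
`J` (the dimension): cylindrifications `c_k`, diagonal elements `d_ij`, interior operators `I_k`.
The laws are imposed by `CylindricAlgebra` and `TopCylindricAlgebra`. -/
class TopCylOps (J : Type*) (A : Type*) where
  cyl : J → A → A
  diag : J → J → A
  int : J → A → A

namespace TopCylOps

variable {J A : Type*} [BooleanAlgebra A] [TopCylOps J A]

/-- The dimension set `Δ p = {i | c_i p ≠ p}`. -/
def dimSet (J : Type*) {A : Type*} [TopCylOps J A] (p : A) : Set J := {i | cyl i p ≠ p}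

/-- `q_i p = - c_i (- p)`. -/
def univ (i : J) (p : A) : A := (cyl i pᶜ)ᶜ

/-- The replacement operation `s^i_j p = c_i (d_ij · p)` ("substitute `j` for `i`"). -/
def subst (i j : J) (p : A) : A := cyl i (diag i j ⊓ p)

end TopCylOps

open TopCylOps in
/-- Cylindric algebras of dimension `J` (the Boolean axioms are those of `BooleanAlgebra`). -/
class CylindricAlgebra (J : Type*) (A : Type*) [BooleanAlgebra A] [TopCylOps J A] : Prop where
  cyl_bot : ∀ i : J, cyl i (⊥ : A) = ⊥
  le_cyl : ∀ (i : J) (x : A), x ≤ cyl i x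
  cyl_inf_cyl : ∀ (i : J) (x y : A), cyl i (x ⊓ cyl i y) = cyl i x ⊓ cyl i y
  cyl_comm : ∀ (i j : J) (x : A), cyl i (cyl j x) = cyl j (cyl i x)
  diag_self : ∀ i : J, (diag i i : A) = ⊤
  diag_eq : ∀ i j k : J, k ≠ i → k ≠ j → (diag i j : A) = cyl k (diag i k ⊓ diag j k)
  cyl_diag_disjoint : ∀ (i j : J) (x : A), i ≠ j →
    cyl i (diag i j ⊓ x) ⊓ cyl i (diag i j ⊓ xᶜ) = ⊥

open TopCylOps in
/-- Topological cylindric algebras of dimension `J`. In `univ_le_univ_int` the Boolean term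
`(-p + q) · (-q + p)` is written out. -/
class TopCylindricAlgebra (J : Type*) (A : Type*) [BooleanAlgebra A] [TopCylOps J A] : Prop
    extends CylindricAlgebra J A where
  univ_le_univ_int : ∀ (i : J) (p q : A),
    univ i ((pᶜ ⊔ q) ⊓ (qᶜ ⊔ p)) ≤
      univ i (((int i p)ᶜ ⊔ int i q) ⊓ ((int i q)ᶜ ⊔ int i p))
  int_le : ∀ (i : J) (p : A), int i p ≤ p
  int_inf : ∀ (i : J) (p q : A), int i p ⊓ int i q = int i (p ⊓ q)
  int_le_int_int : ∀ (i : J) (p : A), int i p ≤ int i (int i p)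
  int_top : ∀ i : J, int i (⊤ : A) = ⊤
  cyl_int : ∀ (i k : J) (p : A), k ≠ i → k ∉ dimSet J p → cyl k (int i p) = int i p
  subst_int : ∀ (i j : J) (p : A), j ∉ dimSet J p →
    subst i j (int i p) = int j (subst i j p)

/-- Embeddings (injective homomorphisms) of algebras in the signature of topological cylindric
algebras of dimension `J`. Boolean complements are preserved automatically. -/
structure TopCylEmbedding (J A B : Type*) [BooleanAlgebra A] [TopCylOps J A]
    [BooleanAlgebra B] [TopCylOps J B] extends BoundedLatticeHom A B where
  map_cyl : ∀ (i : J) (x : A), toFun (TopCylOps.cyl i x) = TopCylOps.cyl i (toFun x)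
  map_diag : ∀ i j : J, toFun (TopCylOps.diag i j) = TopCylOps.diag i j
  map_int : ∀ (i : J) (x : A), toFun (TopCylOps.int i x) = TopCylOps.int i (toFun x)
  injective : Function.Injective toFun

/-! ### Neat reducts -/

namespace CylindricAlgebra

open TopCylOps

variable {J A : Type*} [BooleanAlgebra A] [TopCylOps J A] [CylindricAlgebra J A]

theorem cyl_top (i : J) : cyl i (⊤ : A) = ⊤ := top_le_iff.mp (le_cyl i ⊤)

theorem cyl_cyl (i : J) (x : A) : cyl i (cyl i x) = cyl i x := by
  have h := cyl_inf_cyl i (⊤ : A) x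
  rwa [top_inf_eq, cyl_top, top_inf_eq] at h

theorem cyl_inf_eq {i : J} {x y : A} (hx : cyl i x = x) (hy : cyl i y = y) :
    cyl i (x ⊓ y) = x ⊓ y := by
  have h := cyl_inf_cyl i x y
  rwa [hx, hy] at h

theorem cyl_compl_eq {i : J} {x : A} (hx : cyl i x = x) : cyl i xᶜ = xᶜ := by
  refine le_antisymm ?_ (le_cyl i _)
  have h := cyl_inf_cyl i xᶜ x
  rw [hx, compl_inf_eq_bot, cyl_bot] at h
  exact le_compl_iff_disjoint_right.mpr (disjoint_iff.mpr h.symm)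

theorem cyl_sup_eq {i : J} {x y : A} (hx : cyl i x = x) (hy : cyl i y = y) :
    cyl i (x ⊔ y) = x ⊔ y := by
  have h := cyl_compl_eq (cyl_inf_eq (cyl_compl_eq hx) (cyl_compl_eq hy))
  rwa [compl_inf, compl_compl, compl_compl] at h

theorem cyl_diag {i j k : J} (hi : k ≠ i) (hj : k ≠ j) :
    cyl k (diag i j : A) = diag i j := by
  rw [diag_eq i j k hi hj, cyl_cyl]

end CylindricAlgebra

section NeatReduct

open TopCylOps

variable {J K : Type*} (e : J ↪ K) (B : Type*) [BooleanAlgebra B] [TopCylOps K B]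
  [TopCylindricAlgebra K B]

/-- The universe `{b | Δ b ⊆ J}` of the neat `J`-reduct of an algebra of dimension `K`, where `J` is
regarded as a subset of `K` through the injection `e`; it is a Boolean subalgebra. -/
def neatReduct : BooleanSubalgebra B where
  carrier := {b | dimSet K b ⊆ Set.range e}
  supClosed' := by
    intro x hx y hy k hk
    by_contra hke
    exact hk (CylindricAlgebra.cyl_sup_eq (not_not.mp fun h => hke (hx h))
      (not_not.mp fun h => hke (hy h)))
  infClosed' := by
    intro x hx y hy k hk
    by_contra hke
    exact hk (CylindricAlgebra.cyl_inf_eq (not_not.mp fun h => hke (hx h))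
      (not_not.mp fun h => hke (hy h)))
  compl_mem' := by
    intro x hx k hk
    by_contra hke
    exact hk (CylindricAlgebra.cyl_compl_eq (not_not.mp fun h => hke (hx h)))
  bot_mem' := by
    intro k hk
    exact absurd (CylindricAlgebra.cyl_bot k) hk

/-- The operations of the neat reduct: those of `B` with indices in `J`. -/
instance neatReductOps : TopCylOps J (neatReduct e B) where
  cyl j b := ⟨cyl (e j) b.1, by
    intro k hk
    by_contra hke
    refine hk ?_
    rw [CylindricAlgebra.cyl_comm, not_not.mp fun h => hke (b.2 h)]⟩
  diag i j := ⟨diag (e i) (e j), by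
    intro k hk
    by_contra hke
    exact hk (CylindricAlgebra.cyl_diag (fun h => hke ⟨i, h.symm⟩) (fun h => hke ⟨j, h.symm⟩))⟩
  int j b := ⟨int (e j) b.1, by
    intro k hk
    by_contra hke
    exact hk (TopCylindricAlgebra.cyl_int (e j) k b.1 (fun h => hke ⟨j, h.symm⟩)
      (fun h => hke (b.2 h)))⟩

end NeatReduct

/-- The inclusion of the index set of dimension `α` into that of dimension `β ≥ α`. -/
noncomputable def ordinalInclusion {α β : Ordinal} (h : α ≤ β) : α.ToType ↪ β.ToType :=
  Ordinal.ToType.mk.symm.toEquiv.toEmbedding.trans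
    ((Set.embeddingOfSubset _ _ (Set.Iio_subset_Iio h)).trans
      Ordinal.ToType.mk.toEquiv.toEmbedding)

/-- `A ∈ S Nr_α TCA_β`: `A` embeds into the neat `α`-reduct of some topological cylindric algebra
of dimension `β`. -/
def MemSNrTCA {α β : Ordinal.{u}} (h : α ≤ β) (A : Type u) [BooleanAlgebra A]
    [TopCylOps α.ToType A] : Prop :=
  ∃ (B : Type u) (_ : BooleanAlgebra B) (_ : TopCylOps β.ToType B)
    (_ : TopCylindricAlgebra β.ToType B),
    Nonempty (TopCylEmbedding α.ToType A (neatReduct (ordinalInclusion h) B))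

/-! ### Topological set algebras -/

open Classical in
/-- The set algebra of all subsets of a unit `V ⊆ ᴶU` over a topological space `U`:
`c_k X = {s ∈ V | ∃ t ∈ X, t ≡_k s}`, `d_ij = {s ∈ V | s_i = s_j}` and
`I_k X = {s ∈ V | s_k ∈ int {a ∈ U | s^k_a ∈ X}}`. -/
instance setAlgebraOps {J U : Type*} [TopologicalSpace U] (V : Set (J → U)) :
    TopCylOps J (Set V) where
  cyl k X := {s | ∃ t ∈ X, ∀ j, j ≠ k → t.1 j = s.1 j}
  diag i j := {s | s.1 i = s.1 j}
  int k X := {s | s.1 k ∈ interior {a : U | Function.update s.1 k a ∈ Subtype.val '' X}}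

/-- Direct products of algebras, with coordinatewise operations. -/
instance piTopCylOps {J I : Type*} (C : I → Type*) [∀ i, TopCylOps J (C i)] :
    TopCylOps J (∀ i, C i) where
  cyl k x := fun i => TopCylOps.cyl k (x i)
  diag j k := fun _ => TopCylOps.diag j k
  int k x := fun i => TopCylOps.int k (x i)

/-- The weak space `ᴶW⁽ᵖ⁾` with subbase `W ⊆ U`. -/
def weakSpaceOn {J U : Type*} (W : Set U) (p : J → U) : Set (J → U) :=
  {s | (∀ j, s j ∈ W) ∧ {j | s j ≠ p j}.Finite}

/-- The weak space `ᴶU⁽ᵖ⁾`. -/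
def weakSpace {J U : Type*} (p : J → U) : Set (J → U) := weakSpaceOn Set.univ p

/-- Generalized weak spaces with base `U`: unions of pairwise disjoint weak spaces with nonempty
subbases, the subbases covering `U`. -/
def IsGenWeakSpace {J U : Type u} (V : Set (J → U)) : Prop :=
  ∃ (I : Type u) (W : I → Set U) (p : I → J → U),
    (∀ i, (W i).Nonempty) ∧ (∀ i j, p i j ∈ W i) ∧ (⋃ i, W i) = Set.univ ∧
    Pairwise (fun i i' => Disjoint (weakSpaceOn (W i) (p i)) (weakSpaceOn (W i') (p i'))) ∧
    V = ⋃ i, weakSpaceOn (W i) (p i)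

/-- `A` is representable: it embeds into a direct product of topological weak set algebras. -/
def TopRepresentable (J A : Type u) [BooleanAlgebra A] [TopCylOps J A] : Prop :=
  ∃ (I : Type u) (U : I → Type u) (_ : ∀ i, Nonempty (U i)) (_ : ∀ i, TopologicalSpace (U i))
    (p : ∀ i, J → U i),
    Nonempty (TopCylEmbedding J A (∀ i, Set (weakSpace (p i))))

/-- `A` is isomorphic to a topological generalized weak set algebra, that is, to a subalgebra of the
algebra of all subsets of a generalized weak space whose base carries a topology. -/
def IsoTopGenWeakSetAlgebra (J A : Type u) [BooleanAlgebra A] [TopCylOps J A] : Prop :=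
  ∃ (U : Type u) (_ : TopologicalSpace U) (V : Set (J → U)),
    IsGenWeakSpace V ∧ Nonempty (TopCylEmbedding J A (Set V))

/-!
An algebra is representable if and only if it is neatly embedded in an algebra with `ω` further
dimensions, and, in dimension at least two, if and only if it is a topological generalized weak set
algebra.

If `A` embeds into a product of full weak set algebras over spaces `U i`, then sending a set of
tuples to the cylinder over it embeds `A` neatly into the product of the full weak set algebras of
the larger dimension over the same spaces (`TopRepresentable.exists_neatReduct_embedding`); these
satisfy the axioms (`weakSetAlgebra_topCylindricAlgebra`).

The converse is a completeness proof in the style of Henkin. The axioms are Horn sentences with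
finitely many indices each, so a reduced power of the given algebra of dimension `α + ω` provides
an algebra `D` whose indices are those of `A`, called variables, together with an arbitrary set of
further indices, called names (`exists_neatReduct_sum_embedding`). The names are taken to be the
terms of the language itself, the term `c_v x` being the name of a witness for `c_v x`. A witness
axiom is consistent with everything in which its name does not occur, and terms are larger than the
names occurring in them, so every nonzero element of `A` lies in an ultrafilter `F`, of the
subalgebra of `D` generated by `A`, that contains all witness axioms (`exists_isHenkin`).

The points of the model of `F` are the names modulo the equalities in `F`. Substituting names for
finitely many variables in `F` yields further ultrafilters, which correspond to the points of a weak
space over the model (`Realizes.unique`, `exists_realizes_of_mem_weakSpace`), and an element `x` is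
sent to the set of those points whose ultrafilter contains `x`. Because substituted variables and
substituted names are disjoint, the substitutions for different variables commute, and no general
calculus of substitutions is needed. For the interior operators, the model gets the topology
generated by the sets definable by elements of the form `I_k x`. All of these can be defined in one
and the same variable, so they form a base, and the extensionality axiom of `I_k` together with the
witnesses shows that the set defined by `I_k x` is the interior of the one defined by `x`
(`interior_definableSet`).

For the second equivalence, a product of full weak set algebras is the algebra of all subsets of a
generalized weak space over the disjoint union of the base spaces; in dimension at least two, moving
one coordinate cannot leave a component. Conversely, a component of a generalized weak space is
always closed under such moves inside the whole space (`component_unique`), and the law `I_k 1 = 1`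
in `A` makes the subbases open (`isOpen_of_int_top`), so that interiors can be computed within each
component.
-/

/-! ### Cylindrifications, diagonals and replacements -/

namespace TopCylOps

open CylindricAlgebra TopCylindricAlgebra

section Cylindric

variable {K A : Type*} [BooleanAlgebra A] [TopCylOps K A] [CylindricAlgebra K A]

theorem cyl_mono (i : K) {x y : A} (h : x ≤ y) : cyl i x ≤ cyl i y := by
  have hx : x ⊓ cyl i y = x := inf_eq_left.mpr (h.trans (le_cyl i y))
  rw [← hx, cyl_inf_cyl]
  exact inf_le_right

theorem cyl_le_of_le {i : K} {x y : A} (hy : cyl i y = y) (h : x ≤ y) : cyl i x ≤ y :=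
  (cyl_mono i h).trans hy.le

theorem cyl_inf_of_cyl_eq {i : K} (x : A) {y : A} (hy : cyl i y = y) :
    cyl i (x ⊓ y) = cyl i x ⊓ y := by
  have h := cyl_inf_cyl i x y
  rwa [hy] at h

theorem inf_cyl_of_cyl_eq {i : K} {x : A} (y : A) (hx : cyl i x = x) :
    cyl i (x ⊓ y) = x ⊓ cyl i y := by
  rw [inf_comm, cyl_inf_of_cyl_eq y hx, inf_comm]

theorem cyl_sup (i : K) (x y : A) : cyl i (x ⊔ y) = cyl i x ⊔ cyl i y :=
  le_antisymm
    (cyl_le_of_le (cyl_sup_eq (cyl_cyl i x) (cyl_cyl i y))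
      (sup_le_sup (le_cyl i x) (le_cyl i y)))
    (sup_le (cyl_mono i le_sup_left) (cyl_mono i le_sup_right))

theorem univ_le (i : K) (x : A) : univ i x ≤ x :=
  compl_le_iff_compl_le.mp (le_cyl i xᶜ)

theorem cyl_univ (i : K) (x : A) : cyl i (univ i x) = univ i x :=
  cyl_compl_eq (cyl_cyl i xᶜ)

theorem univ_mono (i : K) {x y : A} (h : x ≤ y) : univ i x ≤ univ i y :=
  compl_le_compl (cyl_mono i (compl_le_compl h))

theorem le_univ_of_le {i : K} {x y : A} (hx : cyl i x = x) (h : x ≤ y) : x ≤ univ i y := by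
  refine le_trans (le_of_eq ?_) (univ_mono i h)
  rw [univ, cyl_compl_eq hx, compl_compl]

/-- The third index needed to derive symmetry of the diagonal exists in infinite dimension. -/
theorem diag_comm [Infinite K] (i j : K) : (diag i j : A) = diag j i := by
  classical
  obtain ⟨k, hk⟩ := Infinite.exists_notMem_finset ({i, j} : Finset K)
  simp only [Finset.mem_insert, Finset.mem_singleton, not_or] at hk
  rw [diag_eq i j k hk.1 hk.2, diag_eq j i k hk.2 hk.1, inf_comm]

theorem diag_trans [Infinite K] (i j k : K) : (diag i k ⊓ diag k j : A) ≤ diag i j := by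
  by_cases hi : k = i
  · subst hi; exact inf_le_right
  by_cases hj : k = j
  · subst hj; exact inf_le_left
  rw [diag_eq i j k hi hj, diag_comm k j]
  exact le_cyl k _

theorem cyl_diag_left [Infinite K] (i j : K) : cyl i (diag i j : A) = ⊤ := by
  by_cases h : i = j
  · subst h; rw [diag_self, cyl_top]
  have := diag_eq (A := A) j j i h h
  rw [diag_self, inf_idem, diag_comm] at this
  exact this.symm

theorem diag_inf_subst {i j : K} (h : i ≠ j) (x : A) :
    diag i j ⊓ subst i j x = diag i j ⊓ x := by
  refine le_antisymm (le_inf inf_le_left ?_) (le_inf inf_le_left (le_cyl i _))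
  have hd : Disjoint (subst i j x) (diag i j ⊓ xᶜ) :=
    (disjoint_iff.mpr (cyl_diag_disjoint i j x h)).mono_right (le_cyl i _)
  rw [inf_comm, ← disjoint_compl_right_iff, disjoint_assoc]
  exact hd

theorem subst_mono (i j : K) {x y : A} (h : x ≤ y) : subst i j x ≤ subst i j y :=
  cyl_mono i (inf_le_inf_left _ h)

theorem cyl_subst (i j : K) (x : A) : cyl i (subst i j x) = subst i j x := cyl_cyl i _

theorem subst_of_cyl_eq [Infinite K] (i j : K) {x : A} (hx : cyl i x = x) :
    subst i j x = x := by
  rw [subst, cyl_inf_of_cyl_eq _ hx, cyl_diag_left, top_inf_eq]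

theorem subst_compl [Infinite K] {i j : K} (h : i ≠ j) (x : A) :
    subst i j xᶜ = (subst i j x)ᶜ := by
  symm
  apply IsCompl.compl_eq
  refine ⟨disjoint_iff.mpr (cyl_diag_disjoint i j x h), codisjoint_iff.mpr ?_⟩
  rw [subst, subst, ← cyl_sup, ← inf_sup_left, sup_compl_eq_top, inf_top_eq, cyl_diag_left]

theorem subst_inf {i j : K} (h : i ≠ j) (x y : A) :
    subst i j (x ⊓ y) = subst i j x ⊓ subst i j y := by
  have : diag i j ⊓ (x ⊓ y) = diag i j ⊓ (x ⊓ subst i j y) := by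
    rw [inf_left_comm, ← diag_inf_subst h y, inf_left_comm]
  rw [subst, this, ← inf_assoc, cyl_inf_of_cyl_eq _ (cyl_subst i j y)]
  rfl

theorem cyl_subst_comm {i j k : K} (hi : k ≠ i) (hj : k ≠ j) (x : A) :
    cyl k (subst i j x) = subst i j (cyl k x) := by
  rw [subst, subst, cyl_comm, inf_cyl_of_cyl_eq _ (cyl_diag hi hj)]

theorem cyl_subst_eq {i j k : K} (hi : k ≠ i) (hj : k ≠ j) {x : A} (hx : cyl k x = x) :
    cyl k (subst i j x) = subst i j x := by
  rw [cyl_subst_comm hi hj, hx]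

theorem subst_subst {i j i' j' : K} (hi : i ≠ i') (hj : j ≠ i') (x : A) :
    subst i j (subst i' j' x) = cyl i (cyl i' (diag i j ⊓ (diag i' j' ⊓ x))) := by
  rw [inf_cyl_of_cyl_eq _ (cyl_diag hi.symm hj.symm)]
  rfl

theorem subst_comm {i j i' j' : K} (hi : i ≠ i') (hj : j ≠ i') (hj' : j' ≠ i) (x : A) :
    subst i j (subst i' j' x) = subst i' j' (subst i j x) := by
  rw [subst_subst hi hj, subst_subst hi.symm hj', cyl_comm, inf_left_comm]

/-- Replacing `i` by `i'` and then `i'` by `c` amounts to replacing `i` by `c`, if `x` does not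
depend on `i'`. -/
theorem subst_subst_trans [Infinite K] {i i' c : K} (hi : i ≠ i') (hc : c ≠ i) (hc' : c ≠ i')
    {x : A} (hx : cyl i' x = x) : subst i' c (subst i i' x) = subst i c x := by
  rw [subst_subst hi.symm hc, cyl_comm, ← inf_assoc, cyl_inf_of_cyl_eq _ hx, subst,
    diag_eq i c i' hi.symm hc'.symm, inf_comm (diag i i'), diag_comm c i']

theorem subst_diag [Infinite K] {i j k : K} (hj : i ≠ j) (hk : i ≠ k) :
    subst i j (diag k i : A) = diag k j := by
  rw [subst, diag_comm i j, inf_comm, diag_eq k j i hk hj]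

/-- Equal parameters may be exchanged. -/
theorem diag_inf_subst_le [Infinite K] {i c c' : K} (hc : i ≠ c) (hc' : i ≠ c') (x : A) :
    diag c c' ⊓ subst i c x ≤ subst i c' x := by
  rw [subst, ← inf_cyl_of_cyl_eq _ (cyl_diag hc hc'), ← inf_assoc, inf_comm (diag c c')]
  exact cyl_mono i (inf_le_inf_right x (diag_trans i c' c))

end Cylindric

section Topological

variable {K A : Type*} [BooleanAlgebra A] [TopCylOps K A] [TopCylindricAlgebra K A]

theorem cyl_int_of_cyl_eq {i k : K} {x : A} (h : k ≠ i) (hx : cyl k x = x) :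
    cyl k (int i x) = int i x :=
  cyl_int i k x h (not_not_intro hx)

theorem int_mono (i : K) {x y : A} (h : x ≤ y) : int i x ≤ int i y := by
  rw [← inf_eq_left, int_inf, inf_eq_left.mpr h]

theorem inf_eq_inf_iff_le {z x y : A} :
    z ⊓ x = z ⊓ y ↔ z ≤ (xᶜ ⊔ y) ⊓ (yᶜ ⊔ x) := by
  rw [le_inf_iff, sup_comm xᶜ, sup_comm yᶜ, ← himp_eq, ← himp_eq, le_himp_iff, le_himp_iff]
  constructor
  · intro h
    exact ⟨h.le.trans inf_le_right, h.ge.trans inf_le_right⟩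
  · rintro ⟨h1, h2⟩
    exact le_antisymm (le_inf inf_le_left h1) (le_inf inf_le_left h2)

/-- The extensionality axiom of the interior operators, relative to an element `z` that does not
depend on the variable `i`. -/
theorem inf_int_congr {i : K} {z x y : A} (hz : cyl i z = z) (h : z ⊓ x = z ⊓ y) :
    z ⊓ int i x = z ⊓ int i y := by
  rw [inf_eq_inf_iff_le] at h ⊢
  exact ((le_univ_of_le hz h).trans (univ_le_univ_int i x y)).trans (univ_le i _)

/-- Interior operators commute with replacements that do not involve their variable. -/
theorem int_subst [Infinite K] {i j k : K} (hij : i ≠ j) (hi : k ≠ i) (hj : k ≠ j) (x : A) :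
    int k (subst i j x) = subst i j (int k x) := by
  have h := inf_int_congr (cyl_diag hi hj) (diag_inf_subst hij x)
  have hc : cyl i (int k (subst i j x)) = int k (subst i j x) :=
    cyl_int_of_cyl_eq hi.symm (cyl_subst i j x)
  rw [subst.eq_def i j (int k x), ← h, cyl_inf_of_cyl_eq _ hc, cyl_diag_left, top_inf_eq]

end Topological

end TopCylOps

/-! ### Boolean ultrafilters -/

/-- Ultrafilters of a Boolean algebra, as sets of elements. -/
structure IsBoolUltrafilter {B : Type*} [BooleanAlgebra B] (F : Set B) : Prop where
  mem_of_le : ∀ {x y}, x ∈ F → x ≤ y → y ∈ F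
  inf_mem : ∀ {x y}, x ∈ F → y ∈ F → x ⊓ y ∈ F
  compl_mem_iff : ∀ {x}, xᶜ ∈ F ↔ x ∉ F

namespace IsBoolUltrafilter

variable {B : Type*} [BooleanAlgebra B] {F : Set B}

theorem top_mem (hF : IsBoolUltrafilter F) : ⊤ ∈ F := by
  by_cases h : (⊤ : B) ∈ F
  · exact h
  · exact hF.mem_of_le (hF.compl_mem_iff.mpr h) le_top

theorem bot_notMem (hF : IsBoolUltrafilter F) : ⊥ ∉ F := by
  have h := hF.top_mem
  rwa [← compl_bot, hF.compl_mem_iff] at h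

theorem inf_mem_iff (hF : IsBoolUltrafilter F) {x y : B} : x ⊓ y ∈ F ↔ x ∈ F ∧ y ∈ F :=
  ⟨fun h => ⟨hF.mem_of_le h inf_le_left, hF.mem_of_le h inf_le_right⟩,
    fun h => hF.inf_mem h.1 h.2⟩

theorem sup_mem_iff (hF : IsBoolUltrafilter F) {x y : B} : x ⊔ y ∈ F ↔ x ∈ F ∨ y ∈ F := by
  rw [← not_iff_not, ← hF.compl_mem_iff, compl_sup, hF.inf_mem_iff, hF.compl_mem_iff,
    hF.compl_mem_iff, not_or]

/-- A directed family of nonzero elements lies in some ultrafilter. -/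
theorem exists_of_directed {ι : Type*} [Nonempty ι] (f : ι → B) (hd : Directed (· ≥ ·) f)
    (h0 : ∀ i, f i ≠ ⊥) : ∃ F : Set B, IsBoolUltrafilter F ∧ ∀ i, f i ∈ F := by
  have hP : Order.IsPFilter {x | ∃ i, f i ≤ x} := by
    refine Order.IsPFilter.of_def ?_ ?_ ?_
    · exact ⟨f (Classical.arbitrary ι), Classical.arbitrary ι, le_rfl⟩
    · rintro x ⟨i, hi⟩ y ⟨j, hj⟩
      obtain ⟨k, hk1, hk2⟩ := hd i j
      exact ⟨f k, ⟨k, le_rfl⟩, hk1.trans hi, hk2.trans hj⟩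
    · rintro x y hxy ⟨i, hi⟩
      exact ⟨i, hi.trans hxy⟩
  obtain ⟨M, hM, -, hdis⟩ := DistribLattice.prime_ideal_of_disjoint_filter_ideal
    (F := hP.toPFilter) (I := Order.Ideal.principal (⊥ : B)) (by
      rw [Set.disjoint_left]
      rintro x ⟨i, hi⟩ hx
      have hx' : x = ⊥ := le_bot_iff.mp (Order.Ideal.mem_principal.mp hx)
      subst hx'
      exact h0 i (le_bot_iff.mp hi))
  rw [Set.disjoint_left] at hdis
  refine ⟨{x | x ∉ M}, ⟨?_, ?_, ?_⟩, fun i => hdis ⟨i, le_rfl⟩⟩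
  · intro x y hx hxy hy
    exact hx (M.lower hxy hy)
  · intro x y hx hy hxy
    exact (hM.mem_or_mem hxy).elim hx hy
  · intro x
    constructor
    · intro h h'
      exact h' ((hM.mem_or_compl_mem (x := x)).resolve_right h)
    · intro h h'
      have h1 : x ∈ M := not_not.mp h
      have h2 := Order.Ideal.sup_mem h1 h'
      rw [sup_compl_eq_top] at h2
      exact hdis ⟨Classical.arbitrary ι, le_top⟩ h2

end IsBoolUltrafilter

/-! ### Set algebras -/

theorem mem_int_setAlgebra {J U : Type*} [inst : DecidableEq J] [TopologicalSpace U]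
    {V : Set (J → U)} (k : J) (X : Set V) (s : V) : s ∈ TopCylOps.int k X ↔
      s.1 k ∈ interior {a : U | Function.update s.1 k a ∈ Subtype.val '' X} := by
  obtain rfl : inst = fun a b => Classical.propDecidable (a = b) := Subsingleton.elim _ _
  exact Iff.rfl

/-! ### Henkin ultrafilters and their models -/

open TopCylOps CylindricAlgebra TopCylindricAlgebra

section Henkin

variable {J C B : Type*} [BooleanAlgebra B] [TopCylOps (J ⊕ C) B]

/-- Ultrafilters of an algebra whose index set consists of variables `J` and names `C`, such that
every existential statement over a variable is witnessed by a name, and every variable is equal to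
some name. -/
structure IsHenkin (F : Set B) : Prop extends IsBoolUltrafilter F where
  exists_witness : ∀ (j : J) (x : B), cyl (.inl j : J ⊕ C) x ∈ F →
    ∃ c : C, subst (.inl j : J ⊕ C) (.inr c) x ∈ F
  exists_name : ∀ j : J, ∃ c : C, diag (.inl j : J ⊕ C) (.inr c) ∈ F

/-- The ultrafilter obtained from `G` by giving the variable `j` the value named by `c`. -/
def assign (G : Set B) (j : J) (c : C) : Set B :=
  {x | subst (.inl j : J ⊕ C) (.inr c) x ∈ G}

theorem mem_assign {G : Set B} {j : J} {c : C} {x : B} :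
    x ∈ assign G j c ↔ subst (.inl j : J ⊕ C) (.inr c) x ∈ G := Iff.rfl

/-- The ultrafilters obtained from `F` by changing the values of finitely many variables. -/
inductive Reachable (F : Set B) : Set B → Prop
  | refl : Reachable F F
  | assign {G : Set B} (j : J) (c : C) : Reachable F G → Reachable F (assign G j c)

/-- Giving a variable the value that it already has changes nothing. -/
theorem assign_eq_self [TopCylindricAlgebra (J ⊕ C) B] {G : Set B}
    (hG : IsBoolUltrafilter G) {j : J} {c : C} (h : diag (.inl j : J ⊕ C) (.inr c) ∈ G) :
    assign G j c = G := by
  ext x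
  have h1 := diag_inf_subst (A := B) (i := (.inl j : J ⊕ C)) (j := .inr c) Sum.inl_ne_inr x
  have h2 : diag (.inl j : J ⊕ C) (.inr c) ⊓ subst (.inl j : J ⊕ C) (.inr c) x ∈ G ↔
      diag (.inl j : J ⊕ C) (.inr c) ⊓ x ∈ G := by rw [h1]
  rw [hG.inf_mem_iff, hG.inf_mem_iff] at h2
  rw [mem_assign]
  simpa [h] using h2

section Assign

variable [TopCylindricAlgebra (J ⊕ C) B] [Infinite C]

theorem IsBoolUltrafilter.assign {G : Set B} (hG : IsBoolUltrafilter G) (j : J) (c : C) :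
    IsBoolUltrafilter (assign G j c) where
  mem_of_le hx hxy := hG.mem_of_le hx (subst_mono _ _ hxy)
  inf_mem {x y} hx hy := by
    rw [mem_assign, subst_inf Sum.inl_ne_inr]
    exact hG.inf_mem hx hy
  compl_mem_iff {x} := by
    rw [mem_assign, mem_assign, subst_compl Sum.inl_ne_inr, hG.compl_mem_iff]

theorem mem_assign_of_cyl_eq {G : Set B} {j : J} {c : C} {x : B}
    (hx : cyl (.inl j : J ⊕ C) x = x) : x ∈ assign G j c ↔ x ∈ G := by
  rw [mem_assign, subst_of_cyl_eq _ _ hx]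

theorem diag_mem_assign_self {G : Set B} (j : J) (c c' : C) :
    diag (.inl j : J ⊕ C) (.inr c') ∈ assign G j c ↔ diag (.inr c : J ⊕ C) (.inr c') ∈ G := by
  have : (diag (.inl j : J ⊕ C) (.inr c') : B) = diag (.inr c' : J ⊕ C) (.inl j) := diag_comm _ _
  rw [mem_assign, this, subst_diag Sum.inl_ne_inr Sum.inl_ne_inr, diag_comm]

theorem diag_mem_assign_of_ne {G : Set B} {j k : J} (h : k ≠ j) (c c' : C) :
    diag (.inl k : J ⊕ C) (.inr c') ∈ assign G j c ↔ diag (.inl k : J ⊕ C) (.inr c') ∈ G :=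
  mem_assign_of_cyl_eq (cyl_diag (fun e => h (Sum.inl_injective e).symm) Sum.inl_ne_inr)

theorem diag_inr_mem_assign {G : Set B} (j : J) (c a b : C) :
    diag (.inr a : J ⊕ C) (.inr b) ∈ assign G j c ↔ diag (.inr a : J ⊕ C) (.inr b) ∈ G :=
  mem_assign_of_cyl_eq (cyl_diag Sum.inl_ne_inr Sum.inl_ne_inr)

theorem subst_mem_assign_self {G : Set B} (j : J) (c c' : C) (x : B) :
    subst (.inl j : J ⊕ C) (.inr c') x ∈ assign G j c ↔
      subst (.inl j : J ⊕ C) (.inr c') x ∈ G :=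
  mem_assign_of_cyl_eq (cyl_subst _ _ _)

theorem IsHenkin.assign {G : Set B} (hG : IsHenkin (J := J) (C := C) G) (j : J) (c : C) :
    IsHenkin (J := J) (C := C) (assign G j c) where
  toIsBoolUltrafilter := hG.toIsBoolUltrafilter.assign j c
  exists_witness k x hx := by
    by_cases hkj : k = j
    · subst hkj
      rw [mem_assign_of_cyl_eq (cyl_cyl _ _)] at hx
      obtain ⟨d, hd⟩ := hG.exists_witness k x hx
      exact ⟨d, (subst_mem_assign_self k c d x).mpr hd⟩
    · have hkj' : (Sum.inl k : J ⊕ C) ≠ .inl j := fun e => hkj (Sum.inl_injective e)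
      rw [mem_assign, ← cyl_subst_comm hkj' Sum.inl_ne_inr] at hx
      obtain ⟨d, hd⟩ := hG.exists_witness k _ hx
      refine ⟨d, ?_⟩
      rwa [mem_assign, subst_comm hkj'.symm Sum.inr_ne_inl Sum.inr_ne_inl]
  exists_name k := by
    by_cases hkj : k = j
    · subst hkj
      refine ⟨c, ?_⟩
      rw [diag_mem_assign_self, diag_self]
      exact hG.top_mem
    · obtain ⟨d, hd⟩ := hG.exists_name k
      exact ⟨d, (diag_mem_assign_of_ne hkj c d).mpr hd⟩

theorem Reachable.isHenkin {F G : Set B} (h : Reachable (J := J) (C := C) F G)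
    (hF : IsHenkin (J := J) (C := C) F) : IsHenkin (J := J) (C := C) G := by
  induction h with
  | refl => exact hF
  | assign j c _ ih => exact ih.assign j c

theorem Reachable.diag_mem_iff {F G : Set B} (h : Reachable (J := J) (C := C) F G) (a b : C) :
    diag (.inr a : J ⊕ C) (.inr b) ∈ G ↔ diag (.inr a : J ⊕ C) (.inr b) ∈ F := by
  induction h with
  | refl => exact Iff.rfl
  | assign j c _ ih => rw [diag_inr_mem_assign, ih]

theorem Reachable.exists_finset {F G : Set B} (h : Reachable (J := J) (C := C) F G) :
    ∃ Γ : Finset J, ∀ x : B, (∀ j ∈ Γ, cyl (.inl j : J ⊕ C) x = x) → (x ∈ G ↔ x ∈ F) := by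
  classical
  induction h with
  | refl => exact ⟨∅, fun x _ => Iff.rfl⟩
  | assign j c _ ih =>
    obtain ⟨Γ, hΓ⟩ := ih
    refine ⟨insert j Γ, fun x hx => ?_⟩
    rw [mem_assign_of_cyl_eq (hx j (Finset.mem_insert_self j Γ)),
      hΓ x fun k hk => hx k (Finset.mem_insert_of_mem hk)]

end Assign

variable [TopCylindricAlgebra (J ⊕ C) B] [Infinite C] {F : Set B}

/-- Two names are identified if the ultrafilter contains their equality. -/
def nameSetoid (hF : IsHenkin (J := J) (C := C) F) : Setoid C where
  r a b := diag (.inr a : J ⊕ C) (.inr b) ∈ F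
  iseqv :=
    { refl := fun a => by rw [diag_self]; exact hF.top_mem
      symm := fun {a b} h => by rwa [diag_comm]
      trans := fun {a b c} h h' => hF.mem_of_le (hF.inf_mem h h') (diag_trans _ _ _) }

/-- The universe of the model of a Henkin ultrafilter. -/
abbrev NameQuot (hF : IsHenkin (J := J) (C := C) F) := Quotient (nameSetoid hF)

/-- The class of a name in the model. -/
abbrev NameQuot.mk (hF : IsHenkin (J := J) (C := C) F) (c : C) : NameQuot hF :=
  Quotient.mk (nameSetoid hF) c

theorem NameQuot.mk_eq_mk (hF : IsHenkin (J := J) (C := C) F) {a b : C} :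
    NameQuot.mk hF a = NameQuot.mk hF b ↔ diag (.inr a : J ⊕ C) (.inr b) ∈ F :=
  Quotient.eq (r := nameSetoid hF)

/-- The reachable ultrafilter `G` gives the variables the values `s`. -/
structure Realizes (hF : IsHenkin (J := J) (C := C) F) (G : Set B) (s : J → NameQuot hF) :
    Prop where
  reachable : Reachable (J := J) (C := C) F G
  diag_mem_iff : ∀ (j : J) (c : C),
    diag (.inl j : J ⊕ C) (.inr c) ∈ G ↔ s j = NameQuot.mk hF c

namespace Realizes

variable {hF : IsHenkin (J := J) (C := C) F} {G G' : Set B} {s s' : J → NameQuot hF}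

theorem isHenkin (h : Realizes hF G s) : IsHenkin (J := J) (C := C) G :=
  h.reachable.isHenkin hF

theorem assign [DecidableEq J] (h : Realizes hF G s) (k : J) (c : C) :
    Realizes hF (_root_.assign G k c) (Function.update s k (NameQuot.mk hF c)) := by
  refine ⟨.assign k c h.reachable, fun j d => ?_⟩
  by_cases hj : j = k
  · subst hj
    rw [diag_mem_assign_self, Function.update_self,
      h.reachable.diag_mem_iff, NameQuot.mk_eq_mk]
  · rw [diag_mem_assign_of_ne hj, Function.update_of_ne hj, h.diag_mem_iff]

theorem tuple_unique (h : Realizes hF G s) (h' : Realizes hF G s') : s = s' := by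
  funext j
  obtain ⟨c, hc⟩ := h.isHenkin.exists_name j
  rw [(h.diag_mem_iff j c).mp hc, (h'.diag_mem_iff j c).mp hc]

/-- A reachable ultrafilter is determined by the values of the variables. -/
theorem unique (h : Realizes hF G s) (h' : Realizes hF G' s) : G = G' := by
  classical
  obtain ⟨Γ, hΓ⟩ := h.reachable.exists_finset
  obtain ⟨Γ', hΓ'⟩ := h'.reachable.exists_finset
  -- The variables on which `G` and `G'` may disagree are eliminated one at a time.
  have key : ∀ Δ : Finset J,
      (∀ x : B, (∀ j ∈ Δ, cyl (.inl j : J ⊕ C) x = x) → (x ∈ G ↔ x ∈ G')) → G = G' := by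
    intro Δ
    induction Δ using Finset.induction_on with
    | empty => exact fun hx => Set.ext fun x => hx x (by simp)
    | insert k Δ hk ih =>
      intro hx
      apply ih
      intro x hxΔ
      obtain ⟨c, hc⟩ := h.isHenkin.exists_name k
      have hc' : diag (.inl k : J ⊕ C) (.inr c) ∈ G' := by
        rwa [h'.diag_mem_iff, ← h.diag_mem_iff]
      rw [← assign_eq_self h.isHenkin.toIsBoolUltrafilter hc,
        ← assign_eq_self h'.isHenkin.toIsBoolUltrafilter hc']
      refine hx _ fun j hj => ?_
      by_cases hjk : j = k
      · subst hjk; exact cyl_subst _ _ _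
      · exact cyl_subst_eq (fun e => hjk (Sum.inl_injective e)) Sum.inl_ne_inr
          (hxΔ j ((Finset.mem_insert.mp hj).resolve_left hjk))
  refine key (Γ ∪ Γ') fun x hx => ?_
  rw [hΓ x fun j hj => hx j (Finset.mem_union_left _ hj),
    hΓ' x fun j hj => hx j (Finset.mem_union_right _ hj)]

end Realizes

/-- The values that a Henkin ultrafilter itself gives to the variables. -/
noncomputable def baseTuple (hF : IsHenkin (J := J) (C := C) F) (j : J) : NameQuot hF :=
  NameQuot.mk hF (hF.exists_name j).choose

theorem realizes_baseTuple (hF : IsHenkin (J := J) (C := C) F) :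
    Realizes hF F (baseTuple hF) := by
  refine ⟨.refl, fun j c => ?_⟩
  have h := (hF.exists_name j).choose_spec
  rw [baseTuple, NameQuot.mk_eq_mk]
  constructor
  · intro h'
    rw [diag_comm] at h
    exact hF.mem_of_le (hF.inf_mem h h') (diag_trans _ _ _)
  · intro h'
    exact hF.mem_of_le (hF.inf_mem h h') (diag_trans _ _ _)

theorem exists_realizes_of_mem_weakSpace (hF : IsHenkin (J := J) (C := C) F)
    {s : J → NameQuot hF} (hs : s ∈ weakSpace (baseTuple hF)) : ∃ G, Realizes hF G s := by
  classical
  have key : ∀ (Γ : Finset J) (s : J → NameQuot hF), (∀ j ∉ Γ, s j = baseTuple hF j) →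
      ∃ G, Realizes hF G s := by
    intro Γ
    induction Γ using Finset.induction_on with
    | empty =>
      intro s hs
      have : s = baseTuple hF := funext fun j => hs j (by simp)
      exact ⟨F, this ▸ realizes_baseTuple hF⟩
    | insert k Γ hk ih =>
      intro s hs
      obtain ⟨G, hG⟩ := ih (Function.update s k (baseTuple hF k)) fun j hj => by
        by_cases hjk : j = k
        · subst hjk; rw [Function.update_self]
        · rw [Function.update_of_ne hjk, hs j (by simp [hj, hjk])]
      obtain ⟨c, hc⟩ := Quotient.exists_rep (s k)
      have h := hG.assign k c
      rw [Function.update_idem, show NameQuot.mk hF c = s k from hc,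
        Function.update_eq_self] at h
      exact ⟨_, h⟩
  exact key hs.2.toFinset s fun j hj => by simpa using hj

theorem Reachable.exists_realizes {G : Set B} (h : Reachable (J := J) (C := C) F G)
    (hF : IsHenkin (J := J) (C := C) F) : ∃ s ∈ weakSpace (baseTuple hF), Realizes hF G s := by
  classical
  induction h with
  | refl => exact ⟨baseTuple hF, ⟨fun _ => trivial, by simp⟩, realizes_baseTuple hF⟩
  | @assign G j c _ ih =>
    obtain ⟨s, hs, hGs⟩ := ih
    refine ⟨_, ⟨fun _ => trivial, ?_⟩, hGs.assign j c⟩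
    refine (hs.2.insert j).subset fun k hk => ?_
    by_cases hkj : k = j
    · exact Or.inl hkj
    · right
      simpa [Function.update_of_ne hkj] using hk

theorem Realizes.mem_weakSpace {hF : IsHenkin (J := J) (C := C) F} {G : Set B}
    {s : J → NameQuot hF} (h : Realizes hF G s) : s ∈ weakSpace (baseTuple hF) := by
  obtain ⟨s', hs', h'⟩ := h.reachable.exists_realizes hF
  rwa [h.tuple_unique h']

/-! ### Definable sets and the topology they generate -/

/-- The subset of the model defined by `x` in the variable `k`, with the parameters given by `G`. -/
def definableSet (hF : IsHenkin (J := J) (C := C) F) (G : Set B) (k : J) (x : B) :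
    Set (NameQuot hF) :=
  {u | ∃ c : C, NameQuot.mk hF c = u ∧ subst (.inl k : J ⊕ C) (.inr c) x ∈ G}

theorem mk_mem_definableSet (hF : IsHenkin (J := J) (C := C) F) {G : Set B}
    (hG : Reachable (J := J) (C := C) F G) {k : J} {x : B} {c : C} :
    NameQuot.mk hF c ∈ definableSet hF G k x ↔ subst (.inl k : J ⊕ C) (.inr c) x ∈ G := by
  constructor
  · rintro ⟨d, hd, hdx⟩
    rw [NameQuot.mk_eq_mk, ← hG.diag_mem_iff] at hd
    exact (hG.isHenkin hF).mem_of_le ((hG.isHenkin hF).inf_mem hd hdx)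
      (diag_inf_subst_le Sum.inl_ne_inr Sum.inl_ne_inr x)
  · exact fun h => ⟨c, rfl, h⟩

theorem definableSet_assign_self (hF : IsHenkin (J := J) (C := C) F) (G : Set B) (k : J) (c : C)
    (x : B) : definableSet hF (assign G k c) k x = definableSet hF G k x := by
  simp only [definableSet, subst_mem_assign_self]

theorem definableSet_assign_of_ne (hF : IsHenkin (J := J) (C := C) F) (G : Set B) {j k : J}
    (h : j ≠ k) (c : C) (x : B) :
    definableSet hF (assign G j c) k x =
      definableSet hF G k (subst (.inl j : J ⊕ C) (.inr c) x) := by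
  have h' : (Sum.inl j : J ⊕ C) ≠ .inl k := fun e => h (Sum.inl_injective e)
  simp only [definableSet, mem_assign, subst_comm h' Sum.inr_ne_inl Sum.inr_ne_inl]

/-- Parameters can be absorbed into the defining element, compatibly with interiors. -/
theorem Reachable.exists_definableSet_eq (hF : IsHenkin (J := J) (C := C) F) {G : Set B}
    (hG : Reachable (J := J) (C := C) F G) (k : J) (x : B) :
    ∃ y, definableSet hF G k x = definableSet hF F k y ∧
      definableSet hF G k (int (.inl k : J ⊕ C) x) =
        definableSet hF F k (int (.inl k : J ⊕ C) y) := by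
  induction hG generalizing x with
  | refl => exact ⟨x, rfl, rfl⟩
  | assign j c _ ih =>
    by_cases h : j = k
    · subst h
      simpa only [definableSet_assign_self] using ih x
    · have h' : (Sum.inl k : J ⊕ C) ≠ .inl j := fun e => h (Sum.inl_injective e).symm
      have := ih (subst (.inl j : J ⊕ C) (.inr c) x)
      rwa [int_subst Sum.inl_ne_inr h' Sum.inl_ne_inr, ← definableSet_assign_of_ne hF _ h,
        ← definableSet_assign_of_ne hF _ h] at this

/-- The variable in which a set is defined can be changed, compatibly with interiors. -/
theorem exists_definableSet_eq_of_var (hF : IsHenkin (J := J) (C := C) F) (i k : J) (x : B) :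
    ∃ y, definableSet hF F i x = definableSet hF F k y ∧
      definableSet hF F i (int (.inl i : J ⊕ C) x) =
        definableSet hF F k (int (.inl k : J ⊕ C) y) := by
  by_cases hik : i = k
  · subst hik; exact ⟨x, rfl, rfl⟩
  have hik' : (Sum.inl i : J ⊕ C) ≠ .inl k := fun e => hik (Sum.inl_injective e)
  -- The new variable `k` is first replaced by a name in `x`.
  obtain ⟨w, hw⟩ := hF.exists_name k
  have hFw := assign_eq_self hF.toIsBoolUltrafilter hw
  have h1 : ∀ z, definableSet hF F i z =
      definableSet hF F i (subst (.inl k : J ⊕ C) (.inr w) z) := fun z => by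
    rw [← definableSet_assign_of_ne hF F (Ne.symm hik) w z, hFw]
  have h2 : ∀ z : B, cyl (.inl k : J ⊕ C) z = z →
      definableSet hF F i z = definableSet hF F k (subst (.inl i : J ⊕ C) (.inl k) z) :=
    fun z hz => by
      simp only [definableSet, subst_subst_trans hik' Sum.inr_ne_inl Sum.inr_ne_inl hz]
  refine ⟨subst (.inl i : J ⊕ C) (.inl k) (subst (.inl k : J ⊕ C) (.inr w) x), ?_, ?_⟩
  · rw [h1, h2 _ (cyl_subst _ _ _)]
  · rw [h1, ← int_subst Sum.inl_ne_inr hik' Sum.inl_ne_inr,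
      h2 _ (cyl_int_of_cyl_eq hik'.symm (cyl_subst _ _ _)),
      subst_int _ _ _ (not_not_intro (cyl_subst _ _ _))]

theorem definableSet_inf (hF : IsHenkin (J := J) (C := C) F) (k : J) (x y : B) :
    definableSet hF F k (x ⊓ y) = definableSet hF F k x ∩ definableSet hF F k y := by
  ext u
  obtain ⟨c, rfl⟩ := Quotient.exists_rep u
  change NameQuot.mk hF c ∈ _ ↔ NameQuot.mk hF c ∈ _ ∩ _
  rw [Set.mem_inter_iff, mk_mem_definableSet hF .refl, mk_mem_definableSet hF .refl,
    mk_mem_definableSet hF .refl, subst_inf Sum.inl_ne_inr, hF.inf_mem_iff]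

theorem definableSet_mono (hF : IsHenkin (J := J) (C := C) F) (k : J) {x y : B} (h : x ≤ y) :
    definableSet hF F k x ⊆ definableSet hF F k y := by
  rintro u ⟨c, rfl, hc⟩
  exact ⟨c, rfl, hF.mem_of_le hc (subst_mono _ _ h)⟩

/-- The sets defined by interiors. -/
def definableOpens (hF : IsHenkin (J := J) (C := C) F) : Set (Set (NameQuot hF)) :=
  {S | ∃ (k : J) (x : B), S = definableSet hF F k (int (.inl k : J ⊕ C) x)}

/-- The topology of the model has the sets defined by interiors as a base. -/
instance nameQuotTopology (hF : IsHenkin (J := J) (C := C) F) :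
    TopologicalSpace (NameQuot hF) :=
  TopologicalSpace.generateFrom (definableOpens hF)

theorem mem_definableOpens_iff (hF : IsHenkin (J := J) (C := C) F) (k : J)
    {S : Set (NameQuot hF)} : S ∈ definableOpens hF ↔
      ∃ x : B, S = definableSet hF F k (int (.inl k : J ⊕ C) x) := by
  constructor
  · rintro ⟨i, x, rfl⟩
    obtain ⟨y, -, hy⟩ := exists_definableSet_eq_of_var hF i k x
    exact ⟨y, hy⟩
  · rintro ⟨x, rfl⟩
    exact ⟨k, x, rfl⟩

theorem isTopologicalBasis_definableOpens (hF : IsHenkin (J := J) (C := C) F) (k : J) :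
    TopologicalSpace.IsTopologicalBasis (definableOpens hF) where
  exists_subset_inter := by
    intro S hS T hT u hu
    obtain ⟨x, rfl⟩ := (mem_definableOpens_iff hF k).mp hS
    obtain ⟨y, rfl⟩ := (mem_definableOpens_iff hF k).mp hT
    refine ⟨_, ⟨k, x ⊓ y, rfl⟩, ?_⟩
    rw [← int_inf, definableSet_inf]
    exact ⟨hu, subset_rfl⟩
  sUnion_eq := by
    refine Set.eq_univ_of_forall fun u => ?_
    refine ⟨_, ⟨k, ⊤, rfl⟩, ?_⟩
    obtain ⟨c, rfl⟩ := Quotient.exists_rep u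
    refine (mk_mem_definableSet hF .refl).mpr ?_
    rw [int_top, subst_of_cyl_eq _ _ (cyl_top _)]
    exact hF.top_mem
  eq_generateFrom := rfl

theorem interior_definableSet_base (hF : IsHenkin (J := J) (C := C) F) (k : J) (x : B) :
    interior (definableSet hF F k x) = definableSet hF F k (int (.inl k : J ⊕ C) x) := by
  apply subset_antisymm
  · intro u hu
    obtain ⟨S, hS, huS, hSx⟩ :=
      (isTopologicalBasis_definableOpens hF k).mem_nhds_iff.mp (mem_interior_iff_mem_nhds.mp hu)
    obtain ⟨y, rfl⟩ := (mem_definableOpens_iff hF k).mp hS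
    -- The inclusion of definable sets becomes, by the Henkin property, an implication in `F`
    -- between the elements defining them, to which extensionality of the interior applies.
    set v : B := int (.inl k : J ⊕ C) y with hv
    set z : B := univ (.inl k : J ⊕ C) (vᶜ ⊔ x) with hz
    have hzF : z ∈ F := by
      rw [hz, TopCylOps.univ, hF.compl_mem_iff]
      intro h
      obtain ⟨c, hc⟩ := hF.exists_witness k _ h
      rw [compl_sup, compl_compl, subst_inf Sum.inl_ne_inr, subst_compl Sum.inl_ne_inr,
        hF.inf_mem_iff, hF.compl_mem_iff] at hc
      exact hc.2 ((mk_mem_definableSet hF .refl).mp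
        (hSx ((mk_mem_definableSet hF .refl).mpr hc.1)))
    have hzv : z ⊓ (v ⊓ x) = z ⊓ v := by
      have : z ⊓ v ≤ x := by
        rw [← le_himp_iff, himp_eq, sup_comm]
        exact univ_le _ _
      rw [← inf_assoc, inf_eq_left.mpr this]
    have hzi := inf_int_congr (cyl_univ (.inl k : J ⊕ C) (vᶜ ⊔ x)) hzv
    obtain ⟨c, rfl⟩ := Quotient.exists_rep u
    refine (mk_mem_definableSet hF .refl).mpr ?_
    have hcv : subst (.inl k : J ⊕ C) (.inr c) v ∈ F := (mk_mem_definableSet hF .refl).mp huS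
    have hcz : subst (.inl k : J ⊕ C) (.inr c) z ∈ F := by
      rwa [subst_of_cyl_eq _ _ (cyl_univ _ _)]
    refine hF.mem_of_le (hF.inf_mem hcz hcv) ?_
    rw [← subst_inf Sum.inl_ne_inr]
    refine subst_mono _ _ ?_
    calc z ⊓ v ≤ z ⊓ int (.inl k : J ⊕ C) v := inf_le_inf_left _ (int_le_int_int _ _)
      _ = z ⊓ int (.inl k : J ⊕ C) (v ⊓ x) := hzi.symm
      _ ≤ int (.inl k : J ⊕ C) x := inf_le_right.trans (int_mono _ inf_le_right)
  · exact interior_maximal (definableSet_mono hF k (int_le _ _))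
      (TopologicalSpace.isOpen_generateFrom_of_mem ⟨k, x, rfl⟩)

theorem interior_definableSet (hF : IsHenkin (J := J) (C := C) F) {G : Set B}
    (hG : Reachable (J := J) (C := C) F G) (k : J) (x : B) :
    interior (definableSet hF G k x) = definableSet hF G k (int (.inl k : J ⊕ C) x) := by
  obtain ⟨y, h1, h2⟩ := hG.exists_definableSet_eq hF k x
  rw [h1, h2, interior_definableSet_base]

/-! ### The homomorphism into the weak set algebra of the model -/

/-- The set of those tuples whose ultrafilter contains `x`. -/
def henkinSet (hF : IsHenkin (J := J) (C := C) F) (x : B) : Set (weakSpace (baseTuple hF)) :=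
  {s | ∃ G, Realizes hF G s.1 ∧ x ∈ G}

section HenkinSet

variable (hF : IsHenkin (J := J) (C := C) F)

theorem mem_henkinSet {hF : IsHenkin (J := J) (C := C) F} {G : Set B}
    {s : weakSpace (baseTuple hF)} (h : Realizes hF G s.1) {x : B} :
    s ∈ henkinSet hF x ↔ x ∈ G := by
  constructor
  · rintro ⟨G', h', hx⟩
    rwa [h.unique h']
  · exact fun hx => ⟨G, h, hx⟩

theorem henkinSet_inf (x y : B) : henkinSet hF (x ⊓ y) = henkinSet hF x ⊓ henkinSet hF y := by
  ext s
  obtain ⟨G, hG⟩ := exists_realizes_of_mem_weakSpace hF s.2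
  change _ ↔ s ∈ henkinSet hF x ∧ s ∈ henkinSet hF y
  rw [mem_henkinSet hG, mem_henkinSet hG, mem_henkinSet hG,
    hG.isHenkin.inf_mem_iff]

theorem henkinSet_sup (x y : B) : henkinSet hF (x ⊔ y) = henkinSet hF x ⊔ henkinSet hF y := by
  ext s
  obtain ⟨G, hG⟩ := exists_realizes_of_mem_weakSpace hF s.2
  change _ ↔ s ∈ henkinSet hF x ∨ s ∈ henkinSet hF y
  rw [mem_henkinSet hG, mem_henkinSet hG, mem_henkinSet hG,
    hG.isHenkin.sup_mem_iff]

theorem henkinSet_top : henkinSet hF (⊤ : B) = ⊤ := by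
  ext s
  obtain ⟨G, hG⟩ := exists_realizes_of_mem_weakSpace hF s.2
  simp [mem_henkinSet hG, hG.isHenkin.top_mem]

theorem henkinSet_bot : henkinSet hF (⊥ : B) = ⊥ := by
  ext s
  obtain ⟨G, hG⟩ := exists_realizes_of_mem_weakSpace hF s.2
  simp [mem_henkinSet hG, hG.isHenkin.bot_notMem]

theorem henkinSet_diag (i j : J) :
    henkinSet hF (diag (.inl i : J ⊕ C) (.inl j)) = diag i j := by
  ext s
  obtain ⟨G, hG⟩ := exists_realizes_of_mem_weakSpace hF s.2
  rw [mem_henkinSet hG]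
  change _ ↔ s.1 i = s.1 j
  obtain ⟨c, hc⟩ := hG.isHenkin.exists_name j
  rw [(hG.diag_mem_iff j c).mp hc, ← hG.diag_mem_iff]
  constructor
  · exact fun h => hG.isHenkin.mem_of_le (hG.isHenkin.inf_mem h hc) (diag_trans _ _ _)
  · intro h
    rw [diag_comm] at hc
    exact hG.isHenkin.mem_of_le (hG.isHenkin.inf_mem h hc) (diag_trans _ _ _)

theorem henkinSet_cyl (k : J) (x : B) :
    henkinSet hF (cyl (.inl k : J ⊕ C) x) = cyl k (henkinSet hF x) := by
  classical
  ext s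
  obtain ⟨G, hG⟩ := exists_realizes_of_mem_weakSpace hF s.2
  rw [mem_henkinSet hG]
  constructor
  · intro h
    obtain ⟨c, hc⟩ := hG.isHenkin.exists_witness k x h
    have hGc := hG.assign k c
    exact ⟨⟨_, hGc.mem_weakSpace⟩, (mem_henkinSet hGc).mpr hc,
      fun j hj => Function.update_of_ne hj _ _⟩
  · rintro ⟨t, ⟨G', hG', hx⟩, hts⟩
    obtain ⟨c, hc⟩ := hG.isHenkin.exists_name k
    have h := hG'.assign k c
    have hst : Function.update t.1 k (NameQuot.mk hF c) = s.1 := by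
      funext j
      by_cases hj : j = k
      · subst hj
        rw [Function.update_self, (hG.diag_mem_iff j c).mp hc]
      · rw [Function.update_of_ne hj, hts j hj]
    rw [hst] at h
    rw [hG.unique h, mem_assign_of_cyl_eq (cyl_cyl _ _)]
    exact hG'.isHenkin.mem_of_le hx (le_cyl _ _)

theorem henkinSet_int (k : J) (x : B) :
    henkinSet hF (int (.inl k : J ⊕ C) x) = int k (henkinSet hF x) := by
  classical
  ext s
  obtain ⟨G, hG⟩ := exists_realizes_of_mem_weakSpace hF s.2
  have hset : {a | Function.update s.1 k a ∈ Subtype.val '' henkinSet hF x} =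
      definableSet hF G k x := by
    ext u
    obtain ⟨c, rfl⟩ := Quotient.exists_rep u
    change _ ↔ NameQuot.mk hF c ∈ _
    have hGc := hG.assign k c
    rw [mk_mem_definableSet hF hG.reachable, ← mem_assign,
      ← mem_henkinSet (s := ⟨_, hGc.mem_weakSpace⟩) hGc]
    simp [hGc.mem_weakSpace]
  obtain ⟨c, hc⟩ := hG.isHenkin.exists_name k
  rw [mem_henkinSet hG]
  rw [mem_int_setAlgebra, hset, interior_definableSet hF hG.reachable, (hG.diag_mem_iff k c).mp hc,
    mk_mem_definableSet hF hG.reachable, ← mem_assign,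
    assign_eq_self hG.isHenkin.toIsBoolUltrafilter hc]

theorem henkinSet_nonempty {x : B} (hx : x ∈ F) : (henkinSet hF x).Nonempty :=
  ⟨⟨_, (realizes_baseTuple hF).mem_weakSpace⟩, F, realizes_baseTuple hF, hx⟩

end HenkinSet

end Henkin

/-! ### Homomorphisms and subalgebras -/

/-- Homomorphisms of algebras in the signature of topological cylindric algebras. -/
structure TopCylHom (J A B : Type*) [BooleanAlgebra A] [TopCylOps J A]
    [BooleanAlgebra B] [TopCylOps J B] extends BoundedLatticeHom A B where
  map_cyl : ∀ (i : J) (x : A), toFun (cyl i x) = cyl i (toFun x)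
  map_diag : ∀ i j : J, toFun (diag i j) = diag i j
  map_int : ∀ (i : J) (x : A), toFun (int i x) = int i (toFun x)

section Subalgebra

variable {K D : Type*} [BooleanAlgebra D] [TopCylOps K D]

/-- A Boolean subalgebra closed under the cylindric and interior operations. -/
structure TopCylSubalgebra (K D : Type*) [BooleanAlgebra D] [TopCylOps K D] extends
    BooleanSubalgebra D where
  cyl_mem' : ∀ (k : K) {x : D}, x ∈ carrier → cyl k x ∈ carrier
  diag_mem' : ∀ i j : K, diag i j ∈ carrier
  int_mem' : ∀ (k : K) {x : D}, x ∈ carrier → int k x ∈ carrier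

instance (L : TopCylSubalgebra K D) : TopCylOps K L.toBooleanSubalgebra where
  cyl k x := ⟨cyl k x.1, L.cyl_mem' k x.2⟩
  diag i j := ⟨diag i j, L.diag_mem' i j⟩
  int k x := ⟨int k x.1, L.int_mem' k x.2⟩

instance [TopCylindricAlgebra K D] (L : TopCylSubalgebra K D) :
    TopCylindricAlgebra K L.toBooleanSubalgebra where
  cyl_bot k := Subtype.ext (cyl_bot k)
  le_cyl k x := le_cyl k x.1
  cyl_inf_cyl k x y := Subtype.ext (cyl_inf_cyl k x.1 y.1)
  cyl_comm i j x := Subtype.ext (cyl_comm i j x.1)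
  diag_self i := Subtype.ext (diag_self i)
  diag_eq i j k hi hj := Subtype.ext (diag_eq i j k hi hj)
  cyl_diag_disjoint i j x h := Subtype.ext (cyl_diag_disjoint i j x.1 h)
  univ_le_univ_int k x y := univ_le_univ_int k x.1 y.1
  int_le k x := int_le k x.1
  int_inf k x y := Subtype.ext (int_inf k x.1 y.1)
  int_le_int_int k x := int_le_int_int k x.1
  int_top k := Subtype.ext (int_top k)
  cyl_int i k x h hk := Subtype.ext (cyl_int i k x.1 h fun h' =>
    hk fun e => h' (congrArg Subtype.val e))
  subst_int i j x hj := Subtype.ext (subst_int i j x.1 fun h' =>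
    hj fun e => h' (congrArg Subtype.val e))

end Subalgebra

/-! ### Reduced powers of larger dimension -/

instance {ι B : Type*} {l : Filter ι} [BooleanAlgebra B] : BooleanAlgebra (l.Germ B) where
  compl := Filter.Germ.map compl
  le_top _ := le_top
  bot_le _ := bot_le
  inf_compl_le_bot x := by
    induction x using Filter.Germ.inductionOn with | _ f => ?_
    exact Filter.Germ.coe_le.mpr (.of_forall fun i => BooleanAlgebra.inf_compl_le_bot (f i))
  top_le_sup_compl x := by
    induction x using Filter.Germ.inductionOn with | _ f => ?_
    exact Filter.Germ.coe_le.mpr (.of_forall fun i => BooleanAlgebra.top_le_sup_compl (f i))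

section ReducedPower

variable {ι K K' B : Type*}

/-- The reduced power of `B` modulo `l`, where the operation with index `k : K'` acts at the place
`i` as the operation of `B` with index `ρ i k`. -/
def ReducedPower (B : Type*) (l : Filter ι) (_ : ι → K' → K) : Type _ := l.Germ B

namespace ReducedPower

variable {l : Filter ι} {ρ : ι → K' → K}

/-- The class of a family in the reduced power. -/
def mk (l : Filter ι) (ρ : ι → K' → K) (f : ι → B) : ReducedPower B l ρ :=
  (f : l.Germ B)

theorem mk_surjective (x : ReducedPower B l ρ) : ∃ f : ι → B, mk l ρ f = x :=
  Quotient.exists_rep x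

theorem mk_eq_mk {f g : ι → B} : mk l ρ f = mk l ρ g ↔ ∀ᶠ i in l, f i = g i :=
  Filter.Germ.coe_eq

instance [TopCylOps K B] : TopCylOps K' (ReducedPower B l ρ) where
  cyl k := Filter.Germ.map' (fun f i => cyl (ρ i k) (f i)) fun f g h => by
    filter_upwards [h] with i hi
    rw [hi]
  diag k k' := mk l ρ fun i => diag (ρ i k) (ρ i k')
  int k := Filter.Germ.map' (fun f i => int (ρ i k) (f i)) fun f g h => by
    filter_upwards [h] with i hi
    rw [hi]

theorem cyl_mk [TopCylOps K B] (k : K') (f : ι → B) :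
    cyl k (mk l ρ f) = mk l ρ fun i => cyl (ρ i k) (f i) := rfl
theorem int_mk [TopCylOps K B] (k : K') (f : ι → B) :
    int k (mk l ρ f) = mk l ρ fun i => int (ρ i k) (f i) := rfl
theorem diag_def [TopCylOps K B] (k k' : K') :
    (diag k k' : ReducedPower B l ρ) = mk l ρ fun i => diag (ρ i k) (ρ i k') := rfl

variable [BooleanAlgebra B]

instance : BooleanAlgebra (ReducedPower B l ρ) := inferInstanceAs (BooleanAlgebra (l.Germ B))

theorem mk_le_mk {f g : ι → B} : mk l ρ f ≤ mk l ρ g ↔ ∀ᶠ i in l, f i ≤ g i :=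
  Filter.Germ.coe_le

theorem inf_mk (f g : ι → B) : mk l ρ f ⊓ mk l ρ g = mk l ρ fun i => f i ⊓ g i := rfl
theorem sup_mk (f g : ι → B) : mk l ρ f ⊔ mk l ρ g = mk l ρ fun i => f i ⊔ g i := rfl
theorem compl_mk (f : ι → B) : (mk l ρ f)ᶜ = mk l ρ fun i => (f i)ᶜ := rfl
theorem top_def : (⊤ : ReducedPower B l ρ) = mk l ρ fun _ => ⊤ := rfl
theorem bot_def : (⊥ : ReducedPower B l ρ) = mk l ρ fun _ => ⊥ := rfl

variable [TopCylOps K B]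

theorem subst_mk (k k' : K') (f : ι → B) :
    subst k k' (mk l ρ f) = mk l ρ fun i => subst (ρ i k) (ρ i k') (f i) := rfl
theorem univ_mk (k : K') (f : ι → B) :
    univ k (mk l ρ f) = mk l ρ fun i => univ (ρ i k) (f i) := rfl

/-- Each axiom mentions finitely many indices, so it suffices that any two different indices are
eventually sent to different indices of `B`. -/
theorem topCylindricAlgebra [TopCylindricAlgebra K B]
    (hρ : ∀ k k', k ≠ k' → ∀ᶠ i in l, ρ i k ≠ ρ i k') :
    TopCylindricAlgebra K' (ReducedPower B l ρ) where
  cyl_bot k := by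
    rw [bot_def, cyl_mk, mk_eq_mk]
    exact .of_forall fun i => cyl_bot _
  le_cyl k x := by
    obtain ⟨f, rfl⟩ := mk_surjective x
    rw [cyl_mk, mk_le_mk]
    exact .of_forall fun i => le_cyl _ _
  cyl_inf_cyl k x y := by
    obtain ⟨f, rfl⟩ := mk_surjective x
    obtain ⟨g, rfl⟩ := mk_surjective y
    simp only [cyl_mk, inf_mk, mk_eq_mk]
    exact .of_forall fun i => cyl_inf_cyl _ _ _
  cyl_comm k k' x := by
    obtain ⟨f, rfl⟩ := mk_surjective x
    simp only [cyl_mk, mk_eq_mk]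
    exact .of_forall fun i => cyl_comm _ _ _
  diag_self k := by
    rw [top_def, diag_def, mk_eq_mk]
    exact .of_forall fun i => diag_self _
  diag_eq i j k hi hj := by
    simp only [diag_def, inf_mk, cyl_mk, mk_eq_mk]
    filter_upwards [hρ k i hi, hρ k j hj] with n h1 h2
    exact diag_eq _ _ _ h1 h2
  cyl_diag_disjoint i j x h := by
    obtain ⟨f, rfl⟩ := mk_surjective x
    simp only [diag_def, compl_mk, inf_mk, cyl_mk, bot_def, mk_eq_mk]
    filter_upwards [hρ i j h] with n h1
    exact cyl_diag_disjoint _ _ _ h1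
  univ_le_univ_int k x y := by
    obtain ⟨f, rfl⟩ := mk_surjective x
    obtain ⟨g, rfl⟩ := mk_surjective y
    simp only [compl_mk, inf_mk, sup_mk, univ_mk, int_mk, mk_le_mk]
    exact .of_forall fun i => univ_le_univ_int _ _ _
  int_le k x := by
    obtain ⟨f, rfl⟩ := mk_surjective x
    rw [int_mk, mk_le_mk]
    exact .of_forall fun i => int_le _ _
  int_inf k x y := by
    obtain ⟨f, rfl⟩ := mk_surjective x
    obtain ⟨g, rfl⟩ := mk_surjective y
    simp only [int_mk, inf_mk, mk_eq_mk]
    exact .of_forall fun i => int_inf _ _ _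
  int_le_int_int k x := by
    obtain ⟨f, rfl⟩ := mk_surjective x
    simp only [int_mk, mk_le_mk]
    exact .of_forall fun i => int_le_int_int _ _
  int_top k := by
    rw [top_def, int_mk, mk_eq_mk]
    exact .of_forall fun i => int_top _
  cyl_int i k x h hk := by
    obtain ⟨f, rfl⟩ := mk_surjective x
    have hk' : cyl k (mk l ρ f) = mk l ρ f := not_not.mp hk
    simp only [cyl_mk, int_mk, mk_eq_mk] at hk' ⊢
    filter_upwards [hk', hρ k i h] with n h1 h2
    exact cyl_int_of_cyl_eq h2 h1
  subst_int i j x hj := by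
    obtain ⟨f, rfl⟩ := mk_surjective x
    have hj' : cyl j (mk l ρ f) = mk l ρ f := not_not.mp hj
    simp only [cyl_mk, int_mk, subst_mk, mk_eq_mk] at hj' ⊢
    filter_upwards [hj'] with n h1
    exact subst_int _ _ _ (not_not_intro h1)

end ReducedPower

end ReducedPower

/-- An algebra that is neatly embedded with infinitely many spare indices is neatly embedded with
any set of spare indices. -/
theorem exists_neatReduct_sum_embedding {J K A B : Type u} (T : Type u) [BooleanAlgebra A]
    [TopCylOps J A] [BooleanAlgebra B] [TopCylOps K B] [TopCylindricAlgebra K B] (e : J ↪ K)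
    (n : ℕ ↪ K) (hn : ∀ j m, n m ≠ e j) (φ : TopCylEmbedding J A (neatReduct e B)) :
    ∃ (D : Type u) (_ : BooleanAlgebra D) (_ : TopCylOps (J ⊕ T) D)
      (_ : TopCylindricAlgebra (J ⊕ T) D),
      Nonempty (TopCylEmbedding J A (neatReduct (Function.Embedding.inl : J ↪ J ⊕ T) D)) := by
  classical
  -- For a finite set `Γ` of new indices, those in `Γ` are sent injectively to spare indices of `B`.
  let q : Finset T → T → ℕ := fun Γ t => Γ.toList.idxOf t
  have hq : ∀ (Γ : Finset T) (t t' : T), t ∈ Γ → q Γ t = q Γ t' → t = t' := fun Γ t t' ht h =>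
    (List.idxOf_inj (Finset.mem_toList.mpr ht)).mp h
  let ρ : Finset T → J ⊕ T → K := fun Γ => Sum.elim e fun t => n (q Γ t)
  have hρ : ∀ k k', k ≠ k' → ∀ᶠ Γ in Filter.atTop, ρ Γ k ≠ ρ Γ k' := by
    rintro (j | t) (j' | t') h
    · exact .of_forall fun Γ h' => h (congrArg _ (e.injective h'))
    · exact .of_forall fun Γ h' => hn _ _ h'.symm
    · exact .of_forall fun Γ h' => hn _ _ h'
    · filter_upwards [Filter.eventually_ge_atTop {t, t'}] with Γ hΓ h'
      exact h (congrArg _ (hq Γ t t' (hΓ (by simp)) (n.injective h')))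
  have hT := ReducedPower.topCylindricAlgebra (B := B) hρ
  refine ⟨ReducedPower B Filter.atTop ρ, inferInstance, inferInstance, hT, ⟨?_⟩⟩
  let g : A → neatReduct (Function.Embedding.inl : J ↪ J ⊕ T)
      (ReducedPower B Filter.atTop ρ) := fun a =>
    ⟨ReducedPower.mk Filter.atTop ρ fun _ => (φ.toFun a).1, by
      rintro (j | t) h
      · exact ⟨j, rfl⟩
      · refine absurd (ReducedPower.mk_eq_mk.mpr (.of_forall fun Γ => ?_)) h
        by_contra h'
        obtain ⟨j, hj⟩ := (φ.toFun a).2 h'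
        exact hn _ _ hj.symm⟩
  exact
    { toFun := g
      map_sup' := fun a b => by
        have h := φ.map_sup' a b
        exact Subtype.ext (ReducedPower.mk_eq_mk.mpr
          (.of_forall fun Γ => congrArg Subtype.val h))
      map_inf' := fun a b => by
        have h := φ.map_inf' a b
        exact Subtype.ext (ReducedPower.mk_eq_mk.mpr
          (.of_forall fun Γ => congrArg Subtype.val h))
      map_top' := Subtype.ext (ReducedPower.mk_eq_mk.mpr
          (.of_forall fun Γ => congrArg Subtype.val φ.map_top'))
      map_bot' := Subtype.ext (ReducedPower.mk_eq_mk.mpr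
          (.of_forall fun Γ => congrArg Subtype.val φ.map_bot'))
      map_cyl := fun j a => Subtype.ext (ReducedPower.mk_eq_mk.mpr
          (.of_forall fun Γ => congrArg Subtype.val (φ.map_cyl j a)))
      map_diag := fun i j => Subtype.ext (ReducedPower.mk_eq_mk.mpr
          (.of_forall fun Γ => congrArg Subtype.val (φ.map_diag i j)))
      map_int := fun j a => Subtype.ext (ReducedPower.mk_eq_mk.mpr
          (.of_forall fun Γ => congrArg Subtype.val (φ.map_int j a)))
      injective := fun a b h => by
        have h' := ReducedPower.mk_eq_mk.mp (congrArg Subtype.val h)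
        obtain ⟨Γ, hΓ⟩ := h'.exists
        exact φ.injective (Subtype.ext hΓ) }

/-! ### Existence of Henkin ultrafilters -/

/-- Terms over the elements of `A` in the variables `J`, and in names which are themselves
terms: the name `cyl v x` is the witness for the element denoted by `cyl v x`. -/
inductive HenkinTerm (J A : Type*)
  | elem (a : A)
  | var (j : J)
  | name (t : HenkinTerm J A)
  | inf (x y : HenkinTerm J A)
  | compl (x : HenkinTerm J A)
  | cyl (v x : HenkinTerm J A)
  | diag (v w : HenkinTerm J A)
  | int (v x : HenkinTerm J A)

namespace HenkinTerm

variable {J A : Type*}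

/-- The index denoted by a term in the position of an index: `var j` denotes the variable `j`,
`name t` denotes the name `t`. Any other term gets the junk value of itself as a name. -/
def index : HenkinTerm J A → J ⊕ HenkinTerm J A
  | var j => .inl j
  | name t => .inr t
  | t => .inr t

/-- The number of symbols of a term. -/
def size : HenkinTerm J A → ℕ
  | elem _ => 0
  | var _ => 0
  | name t => t.size + 1
  | inf x y => x.size + y.size + 1
  | compl x => x.size + 1
  | cyl v x => v.size + x.size + 1
  | diag v w => v.size + w.size + 1
  | int v x => v.size + x.size + 1

theorem index_surjective (k : J ⊕ HenkinTerm J A) : ∃ v : HenkinTerm J A, v.index = k := by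
  rcases k with j | t
  · exact ⟨var j, rfl⟩
  · exact ⟨name t, rfl⟩

theorem index_ne_inr {v t : HenkinTerm J A} (h : v.size < t.size) :
    (.inr t : J ⊕ HenkinTerm J A) ≠ v.index := by
  intro e
  cases v <;> simp only [index, Sum.inr.injEq, reduceCtorEq] at e <;> subst e <;>
    simp only [size] at h <;> omega

instance [Inhabited A] : Infinite (HenkinTerm J A) := by
  refine Infinite.of_injective (fun n : ℕ => compl^[n] (elem default : HenkinTerm J A)) ?_
  have h : ∀ n : ℕ, (compl^[n] (elem default : HenkinTerm J A)).size = n := fun n => by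
    induction n with
    | zero => rfl
    | succ n ih => rw [Function.iterate_succ_apply', size, ih]
  intro m n hmn
  rw [← h m, ← h n]
  exact congrArg size hmn

variable {D : Type*} [BooleanAlgebra D] [TopCylOps (J ⊕ HenkinTerm J A) D]

/-- The element denoted by a term; variables and names denote indices, not elements. -/
def eval (g : A → D) : HenkinTerm J A → D
  | elem a => g a
  | var _ => ⊤
  | name _ => ⊤
  | inf x y => x.eval g ⊓ y.eval g
  | compl x => (x.eval g)ᶜ
  | cyl v x => TopCylOps.cyl v.index (x.eval g)
  | diag v w => TopCylOps.diag v.index w.index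
  | int v x => TopCylOps.int v.index (x.eval g)

/-- The subalgebra of the elements denoted by terms. -/
def evalRange [Inhabited A] (g : A → D) : TopCylSubalgebra (J ⊕ HenkinTerm J A) D where
  carrier := Set.range (eval (J := J) g)
  supClosed' := by
    rintro _ ⟨x, rfl⟩ _ ⟨y, rfl⟩
    exact ⟨compl (inf (compl x) (compl y)), by simp [eval]⟩
  infClosed' := by
    rintro _ ⟨x, rfl⟩ _ ⟨y, rfl⟩
    exact ⟨inf x y, rfl⟩
  compl_mem' := by
    rintro _ ⟨x, rfl⟩
    exact ⟨compl x, rfl⟩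
  bot_mem' := by
    exact ⟨inf (elem default) (compl (elem default)), by simp [eval]⟩
  cyl_mem' := by
    rintro k _ ⟨x, rfl⟩
    obtain ⟨v, rfl⟩ := index_surjective k
    exact ⟨cyl v x, rfl⟩
  diag_mem' i j := by
    obtain ⟨v, rfl⟩ := index_surjective i
    obtain ⟨w, rfl⟩ := index_surjective j
    exact ⟨diag v w, rfl⟩
  int_mem' := by
    rintro k _ ⟨x, rfl⟩
    obtain ⟨v, rfl⟩ := index_surjective k
    exact ⟨int v x, rfl⟩

/-- A name that is at least as large as a term does not occur in it. -/
theorem cyl_eval [TopCylindricAlgebra (J ⊕ HenkinTerm J A) D] {g : A → D} {t : HenkinTerm J A}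
    (hg : ∀ a, TopCylOps.cyl (.inr t : J ⊕ HenkinTerm J A) (g a) = g a) (x : HenkinTerm J A)
    (h : x.size ≤ t.size) :
    TopCylOps.cyl (.inr t : J ⊕ HenkinTerm J A) (x.eval g) = x.eval g := by
  induction x with
  | elem a => exact hg a
  | var j => exact cyl_top _
  | name s => exact cyl_top _
  | inf x y ihx ihy =>
    simp only [size] at h
    exact cyl_inf_eq (ihx (by omega)) (ihy (by omega))
  | compl x ih =>
    simp only [size] at h
    exact cyl_compl_eq (ih (by omega))
  | cyl v x _ ih =>
    simp only [size] at h
    rw [eval, cyl_comm, ih (by omega)]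
  | diag v w _ _ =>
    simp only [size] at h
    exact cyl_diag (index_ne_inr (by omega)) (index_ne_inr (by omega))
  | int v x _ ih =>
    simp only [size] at h
    exact cyl_int_of_cyl_eq (index_ne_inr (by omega)) (ih (by omega))

end HenkinTerm

/-- A witness with a fresh name can be added without contradiction. -/
theorem inf_witness_ne_bot {K D : Type*} [Infinite K] [BooleanAlgebra D] [TopCylOps K D]
    [TopCylindricAlgebra K D] {k w : K} {z y : D} (hz : cyl w z = z)
    (hy : cyl w y = y) (h0 : z ≠ ⊥) : z ⊓ ((cyl k y)ᶜ ⊔ subst k w y) ≠ ⊥ := by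
  intro h
  have h1 : z ≤ cyl k y ⊓ (subst k w y)ᶜ := by
    rw [← disjoint_iff, ← le_compl_iff_disjoint_right, compl_sup, compl_compl] at h
    exact h
  have h2 : subst k w y ≤ zᶜ := le_compl_comm.mp (h1.trans inf_le_right)
  have h3 : cyl w (subst k w y) = cyl k y := by
    rw [subst, cyl_comm, cyl_inf_of_cyl_eq _ hy, diag_comm, cyl_diag_left, top_inf_eq]
  have h4 : cyl k y ≤ zᶜ := h3 ▸ cyl_le_of_le (cyl_compl_eq hz) h2
  exact h0 (disjoint_self.mp (le_compl_iff_disjoint_right.mp ((h1.trans inf_le_left).trans h4)))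

section Existence

open HenkinTerm

variable {J A D : Type*} [Inhabited A] [BooleanAlgebra D] [TopCylOps (J ⊕ HenkinTerm J A) D]

/-- The statement that the name `cyl v x` is a witness for `cyl v x`. -/
def witnessAxiom (g : A → D) (q : HenkinTerm J A × HenkinTerm J A) : D :=
  (TopCylOps.cyl q.1.index (q.2.eval g))ᶜ ⊔ subst q.1.index (.inr (.cyl q.1 q.2)) (q.2.eval g)

variable [TopCylindricAlgebra (J ⊕ HenkinTerm J A) D]

/-- Finitely many witness axioms are consistent with a nonzero element: the one with the largest
name is added last, so that its name is fresh. -/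
theorem inf_witnessAxiom_ne_bot (g : A → D)
    (hg : ∀ t a, TopCylOps.cyl (.inr t : J ⊕ HenkinTerm J A) (g a) = g a) {a : A} (ha : g a ≠ ⊥)
    (s : Finset (HenkinTerm J A × HenkinTerm J A)) : g a ⊓ s.inf (witnessAxiom g) ≠ ⊥ := by
  classical
  induction s using Finset.induction_on_max_value
      (fun q : HenkinTerm J A × HenkinTerm J A => (HenkinTerm.cyl q.1 q.2).size) with
  | empty => simpa using ha
  | insert q s hq hmax ih =>
    obtain ⟨v, x⟩ := q
    rw [Finset.inf_insert, inf_comm (witnessAxiom g _), ← inf_assoc]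
    refine inf_witness_ne_bot (cyl_inf_eq (hg _ _) ?_)
      (cyl_eval (hg _) _ ?_) ih
    · refine Finset.inf_induction
        (p := fun z => TopCylOps.cyl (.inr (.cyl v x) : J ⊕ HenkinTerm J A) z = z) (cyl_top _)
        (fun _ h1 _ h2 => cyl_inf_eq h1 h2) ?_
      rintro ⟨v', x'⟩ hq'
      have hle := hmax _ hq'
      have hne : (Sum.inr (.cyl v x) : J ⊕ HenkinTerm J A) ≠ .inr (.cyl v' x') := by
        intro e
        simp only [Sum.inr.injEq, HenkinTerm.cyl.injEq] at e
        obtain ⟨rfl, rfl⟩ := e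
        exact hq hq'
      have hv : (Sum.inr (.cyl v x) : J ⊕ HenkinTerm J A) ≠ v'.index :=
        index_ne_inr (by simp only [size] at hle ⊢; omega)
      have hx : TopCylOps.cyl (Sum.inr (.cyl v x) : J ⊕ HenkinTerm J A) (x'.eval g) =
          x'.eval g := cyl_eval (hg _) _ (by simp only [size] at hle ⊢; omega)
      refine cyl_sup_eq (cyl_compl_eq ?_) (cyl_subst_eq hv hne hx)
      rw [cyl_comm, hx]
    · simp only [size]; omega

/-- Every nonzero element of the neat reduct lies in a Henkin ultrafilter of the subalgebra of
elements denoted by terms. -/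
theorem exists_isHenkin (g : A → D)
    (hg : ∀ t a, TopCylOps.cyl (.inr t : J ⊕ HenkinTerm J A) (g a) = g a) {a : A}
    (ha : g a ≠ ⊥) :
    ∃ F : Set (evalRange (J := J) g).toBooleanSubalgebra,
      IsHenkin (J := J) (C := HenkinTerm J A) F ∧ ⟨g a, .elem a, rfl⟩ ∈ F := by
  classical
  obtain ⟨F, hF, hmem⟩ := IsBoolUltrafilter.exists_of_directed
    (fun s : Finset (HenkinTerm J A × HenkinTerm J A) => g a ⊓ s.inf (witnessAxiom g))
    (fun s t => ⟨s ∪ t, inf_le_inf_left _ (Finset.inf_mono Finset.subset_union_left),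
      inf_le_inf_left _ (Finset.inf_mono Finset.subset_union_right)⟩)
    (inf_witnessAxiom_ne_bot g hg ha)
  have hwit : ∀ v x : HenkinTerm J A, TopCylOps.cyl v.index (x.eval g) ∈ F →
      subst v.index (.inr (.cyl v x)) (x.eval g) ∈ F := by
    intro v x h
    have h1 : witnessAxiom g (v, x) ∈ F :=
      hF.mem_of_le (hmem {(v, x)}) (by rw [Finset.inf_singleton]; exact inf_le_right)
    rw [witnessAxiom, hF.sup_mem_iff, hF.compl_mem_iff] at h1
    exact h1.resolve_left (not_not_intro h)
  refine ⟨{x | x.1 ∈ F}, ?_, hF.mem_of_le (hmem ∅) inf_le_left⟩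
  refine ⟨⟨fun hx hxy => hF.mem_of_le hx hxy, fun hx hy => hF.inf_mem hx hy,
    hF.compl_mem_iff⟩, ?_, ?_⟩
  · rintro j ⟨_, x, rfl⟩ h
    exact ⟨_, hwit (.var j) x h⟩
  · intro j
    have h := hwit (.name (.var j)) (.diag (.var j) (.name (.var j))) (by
      change TopCylOps.cyl (.inr (.var j) : J ⊕ HenkinTerm J A)
        (TopCylOps.diag (.inl j : J ⊕ HenkinTerm J A) (.inr (.var j))) ∈ F
      rw [diag_comm, cyl_diag_left]
      exact hF.top_mem)
    let w : HenkinTerm J A := .cyl (.name (.var j)) (.diag (.var j) (.name (.var j)))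
    have e : subst (.inr (.var j) : J ⊕ HenkinTerm J A) (.inr w)
        (TopCylOps.diag (.inl j : J ⊕ HenkinTerm J A) (.inr (.var j)) : D) =
          TopCylOps.diag (.inl j : J ⊕ HenkinTerm J A) (.inr w) :=
      subst_diag (by simp [w]) Sum.inr_ne_inl
    exact ⟨w, (e ▸ h :)⟩

end Existence

/-- If an algebra is neatly embedded with enough spare indices, then for each nonzero element of it
there is a homomorphism into a full topological weak set algebra under which it stays nonzero. -/
theorem exists_hom_ne_bot {J A D : Type u} [BooleanAlgebra A] [TopCylOps J A] [BooleanAlgebra D]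
    [TopCylOps (J ⊕ HenkinTerm J A) D] [TopCylindricAlgebra (J ⊕ HenkinTerm J A) D]
    (φ : TopCylEmbedding J A
      (neatReduct (Function.Embedding.inl : J ↪ J ⊕ HenkinTerm J A) D)) {a : A} (ha : a ≠ ⊥) :
    ∃ (U : Type u) (_ : Nonempty U) (_ : TopologicalSpace U) (p : J → U)
      (f : TopCylHom J A (Set (weakSpace p))), f.toFun a ≠ ⊥ := by
  have : Inhabited A := ⟨⊥⟩
  let g : A → D := fun a => (φ.toFun a).1
  have hg : ∀ t a, cyl (.inr t : J ⊕ HenkinTerm J A) (g a) = g a := fun t a => by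
    by_contra h
    obtain ⟨j, hj⟩ := (φ.toFun a).2 h
    exact Sum.inl_ne_inr hj
  have hga : g a ≠ ⊥ := fun h => ha (φ.injective ((Subtype.ext h).trans φ.map_bot'.symm))
  obtain ⟨F, hF, haF⟩ := exists_isHenkin g hg hga
  let g' : A → (HenkinTerm.evalRange (J := J) g).toBooleanSubalgebra :=
    fun a => ⟨g a, .elem a, rfl⟩
  refine ⟨NameQuot hF, ⟨NameQuot.mk hF (.elem ⊥)⟩, inferInstance, baseTuple hF, ?_, ?_⟩
  · exact
      { toFun := fun a => henkinSet hF (g' a)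
        map_sup' := fun a b => by
          rw [← henkinSet_sup]
          exact congrArg _ (Subtype.ext (congrArg Subtype.val (φ.map_sup' a b) :))
        map_inf' := fun a b => by
          rw [← henkinSet_inf]
          exact congrArg _ (Subtype.ext (congrArg Subtype.val (φ.map_inf' a b) :))
        map_top' := by
          rw [← henkinSet_top]
          exact congrArg _ (Subtype.ext (congrArg Subtype.val φ.map_top' :))
        map_bot' := by
          rw [← henkinSet_bot]
          exact congrArg _ (Subtype.ext (congrArg Subtype.val φ.map_bot' :))
        map_cyl := fun j a => by
          rw [← henkinSet_cyl]
          exact congrArg _ (Subtype.ext (congrArg Subtype.val (φ.map_cyl j a) :))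
        map_diag := fun i j => by
          rw [← henkinSet_diag hF]
          exact congrArg _ (Subtype.ext (congrArg Subtype.val (φ.map_diag i j) :))
        map_int := fun j a => by
          rw [← henkinSet_int]
          exact congrArg _ (Subtype.ext (congrArg Subtype.val (φ.map_int j a) :)) }
  · exact (henkinSet_nonempty hF haF).ne_empty

/-- Homomorphisms separating the elements from zero combine to an embedding into a product. -/
theorem topRepresentable_of_exists_hom {J A : Type u} [BooleanAlgebra A] [TopCylOps J A]
    (h : ∀ a : A, a ≠ ⊥ → ∃ (U : Type u) (_ : Nonempty U) (_ : TopologicalSpace U) (p : J → U)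
      (f : TopCylHom J A (Set (weakSpace p))), f.toFun a ≠ ⊥) : TopRepresentable J A := by
  choose U hU hT p f hf using h
  refine ⟨{a : A // a ≠ ⊥}, fun a => U a.1 a.2, fun a => hU a.1 a.2, fun a => hT a.1 a.2,
    fun a => p a.1 a.2, ⟨?_⟩⟩
  exact
    { toFun := fun x a => (f a.1 a.2).toFun x
      map_sup' := fun x y => funext fun a => (f a.1 a.2).map_sup' x y
      map_inf' := fun x y => funext fun a => (f a.1 a.2).map_inf' x y
      map_top' := funext fun a => (f a.1 a.2).map_top'
      map_bot' := funext fun a => (f a.1 a.2).map_bot'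
      map_cyl := fun k x => funext fun a => (f a.1 a.2).map_cyl k x
      map_diag := fun i j => funext fun a => (f a.1 a.2).map_diag i j
      map_int := fun k x => funext fun a => (f a.1 a.2).map_int k x
      injective := by
        have key : ∀ x y : A, (∀ a : {a : A // a ≠ ⊥},
            (f a.1 a.2).toFun x = (f a.1 a.2).toFun y) → x ≤ y := by
          intro x y hxy
          rw [← sdiff_eq_bot_iff]
          by_contra hne
          apply hf _ hne
          have e := map_sdiff' (f _ hne).toBoundedLatticeHom x y
          refine e.trans ?_
          rw [sdiff_eq_bot_iff]
          exact (hxy ⟨_, hne⟩).le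
        intro x y hxy
        exact le_antisymm (key x y fun a => congrFun hxy a)
          (key y x fun a => (congrFun hxy a).symm) }

/-! ### Weak set algebras are topological cylindric algebras -/

section WeakSpace

variable {J U : Type*} {p : J → U}

open Classical in
/-- The tuple `s` with the value at `k` changed to `a`, as an element of the weak space. -/
noncomputable def weakUpdate (s : weakSpace p) (k : J) (a : U) : weakSpace p :=
  ⟨Function.update s.1 k a, fun _ => trivial, (s.2.2.insert k).subset fun j hj => by
    by_cases hjk : j = k
    · exact Or.inl hjk
    · exact Or.inr (by simpa [Function.update_of_ne hjk] using hj)⟩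

theorem coe_weakUpdate [inst : DecidableEq J] (s : weakSpace p) (k : J) (a : U) :
    (weakUpdate s k a).1 = Function.update s.1 k a := by
  obtain rfl : inst = fun a b => Classical.propDecidable (a = b) := Subsingleton.elim _ _
  rfl

theorem weakUpdate_self (s : weakSpace p) (k : J) (a : U) : (weakUpdate s k a).1 k = a := by
  classical rw [coe_weakUpdate, Function.update_self]

theorem weakUpdate_of_ne {j k : J} (h : j ≠ k) (s : weakSpace p) (a : U) :
    (weakUpdate s k a).1 j = s.1 j := by
  classical rw [coe_weakUpdate, Function.update_of_ne h]

theorem weakUpdate_eq_of_forall {s t : weakSpace p} {k : J} (h : ∀ j, j ≠ k → t.1 j = s.1 j) :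
    weakUpdate s k (t.1 k) = t := by
  refine Subtype.ext (funext fun j => ?_)
  by_cases hjk : j = k
  · subst hjk; rw [weakUpdate_self]
  · rw [weakUpdate_of_ne hjk, h j hjk]

theorem weakUpdate_eq_self (s : weakSpace p) (k : J) : weakUpdate s k (s.1 k) = s :=
  weakUpdate_eq_of_forall fun _ _ => rfl

theorem weakUpdate_idem (s : weakSpace p) (k : J) (a b : U) :
    weakUpdate (weakUpdate s k a) k b = weakUpdate s k b := by
  classical exact Subtype.ext (by simp only [coe_weakUpdate, Function.update_idem])

theorem weakUpdate_comm {j k : J} (h : j ≠ k) (s : weakSpace p) (a b : U) :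
    weakUpdate (weakUpdate s j a) k b = weakUpdate (weakUpdate s k b) j a := by
  classical exact Subtype.ext (by simp only [coe_weakUpdate, Function.update_comm h])

variable [TopologicalSpace U]

theorem mem_cyl_weak {k : J} {X : Set (weakSpace p)} {s : weakSpace p} :
    s ∈ cyl k X ↔ ∃ a, weakUpdate s k a ∈ X := by
  constructor
  · rintro ⟨t, ht, hts⟩
    exact ⟨t.1 k, by rwa [weakUpdate_eq_of_forall hts]⟩
  · rintro ⟨a, ha⟩
    exact ⟨_, ha, fun j hj => weakUpdate_of_ne hj s a⟩

theorem mem_int_weak {k : J} {X : Set (weakSpace p)} {s : weakSpace p} :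
    s ∈ int k X ↔ s.1 k ∈ interior {a | weakUpdate s k a ∈ X} := by
  classical
  rw [mem_int_setAlgebra]
  have : {a | Function.update s.1 k a ∈ Subtype.val '' X} = {a | weakUpdate s k a ∈ X} := by
    ext a
    change Function.update s.1 k a ∈ Subtype.val '' X ↔ weakUpdate s k a ∈ X
    rw [← coe_weakUpdate, Subtype.val_injective.mem_set_image]
  rw [this]

theorem mem_univ_weak {k : J} {X : Set (weakSpace p)} {s : weakSpace p} :
    s ∈ univ k X ↔ ∀ a, weakUpdate s k a ∈ X := by
  change ¬ (s ∈ cyl k Xᶜ) ↔ _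
  rw [mem_cyl_weak]
  simp

theorem mem_subst_weak {i j : J} (h : i ≠ j) {X : Set (weakSpace p)} {s : weakSpace p} :
    s ∈ subst i j X ↔ weakUpdate s i (s.1 j) ∈ X := by
  rw [subst, mem_cyl_weak]
  constructor
  · rintro ⟨a, hd, ha⟩
    have hd' : (weakUpdate s i a).1 i = (weakUpdate s i a).1 j := hd
    rw [weakUpdate_self, weakUpdate_of_ne h.symm] at hd'
    rwa [← hd']
  · intro hX
    refine ⟨_, ?_, hX⟩
    change (weakUpdate s i _).1 i = (weakUpdate s i _).1 j
    rw [weakUpdate_self, weakUpdate_of_ne h.symm]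

theorem weakUpdate_mem_iff_of_cyl_eq {k : J} {X : Set (weakSpace p)} (hX : cyl k X = X)
    (s : weakSpace p) (a : U) : weakUpdate s k a ∈ X ↔ s ∈ X := by
  rw [← hX, mem_cyl_weak, mem_cyl_weak]
  simp only [weakUpdate_idem]

theorem int_weak_of_cyl_eq {k : J} {X : Set (weakSpace p)} (hX : cyl k X = X) :
    int k X = X := by
  ext s
  rw [mem_int_weak]
  simp only [weakUpdate_mem_iff_of_cyl_eq hX]
  by_cases h : s ∈ X <;> simp [h]

instance weakSetAlgebra_topCylindricAlgebra :
    TopCylindricAlgebra J (Set (weakSpace p)) where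
  cyl_bot k := by
    ext s
    rw [mem_cyl_weak]
    exact ⟨fun ⟨_, h⟩ => h, False.elim⟩
  le_cyl k X s hs := ⟨s, hs, fun _ _ => rfl⟩
  cyl_inf_cyl k X Y := by
    ext s
    change _ ↔ s ∈ cyl k X ∧ s ∈ cyl k Y
    rw [mem_cyl_weak, mem_cyl_weak, mem_cyl_weak]
    constructor
    · rintro ⟨a, hX, hY⟩
      obtain ⟨b, hb⟩ := mem_cyl_weak.mp hY
      rw [weakUpdate_idem] at hb
      exact ⟨⟨a, hX⟩, b, hb⟩
    · rintro ⟨⟨a, hX⟩, b, hb⟩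
      refine ⟨a, hX, mem_cyl_weak.mpr ⟨b, ?_⟩⟩
      rwa [weakUpdate_idem]
  cyl_comm i j X := by
    by_cases h : i = j
    · subst h; rfl
    ext s
    simp only [mem_cyl_weak]
    constructor
    · rintro ⟨a, b, hab⟩
      exact ⟨b, a, by rwa [weakUpdate_comm (Ne.symm h)]⟩
    · rintro ⟨a, b, hab⟩
      exact ⟨b, a, by rwa [weakUpdate_comm h]⟩
  diag_self i := Set.eq_univ_of_forall fun _ => rfl
  diag_eq i j k hi hj := by
    ext s
    rw [mem_cyl_weak]
    change s.1 i = s.1 j ↔ ∃ a, (weakUpdate s k a).1 i = (weakUpdate s k a).1 k ∧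
      (weakUpdate s k a).1 j = (weakUpdate s k a).1 k
    simp only [weakUpdate_self, weakUpdate_of_ne hi.symm, weakUpdate_of_ne hj.symm]
    exact ⟨fun h => ⟨s.1 j, h, rfl⟩, fun ⟨a, h1, h2⟩ => h1.trans h2.symm⟩
  cyl_diag_disjoint i j X h := by
    ext s
    change s ∈ subst i j X ∧ s ∈ subst i j Xᶜ ↔ False
    rw [mem_subst_weak h, mem_subst_weak h]
    exact ⟨fun h => h.2 h.1, False.elim⟩
  univ_le_univ_int k X Y := by
    intro s hs
    rw [mem_univ_weak] at hs ⊢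
    have hXY : ∀ a, weakUpdate s k a ∈ X ↔ weakUpdate s k a ∈ Y := fun a =>
      ⟨fun h => (hs a).1.resolve_left (not_not_intro h),
        fun h => (hs a).2.resolve_left (not_not_intro h)⟩
    intro a
    have hi : weakUpdate s k a ∈ int k X ↔ weakUpdate s k a ∈ int k Y := by
      simp only [mem_int_weak, weakUpdate_idem, hXY]
    exact ⟨(em _).symm.imp_right hi.mp, (em _).symm.imp_right hi.mpr⟩
  int_le k X s hs := by
    have := interior_subset (mem_int_weak.mp hs)
    rwa [Set.mem_ofPred_eq, weakUpdate_eq_self] at this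
  int_inf k X Y := by
    ext s
    change s ∈ int k X ∧ s ∈ int k Y ↔ _
    rw [mem_int_weak, mem_int_weak, mem_int_weak, ← Set.mem_inter_iff, ← interior_inter]
    rfl
  int_le_int_int k X s hs := by
    rw [mem_int_weak] at hs ⊢
    simp only [mem_int_weak, weakUpdate_idem, weakUpdate_self]
    rwa [Set.ofPred_mem_eq, interior_interior]
  int_top k := by
    refine Set.eq_univ_of_forall fun s => mem_int_weak.mpr ?_
    have : {a | weakUpdate s k a ∈ (⊤ : Set (weakSpace p))} = Set.univ :=
      Set.eq_univ_of_forall fun _ => trivial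
    rw [this, interior_univ]
    trivial
  cyl_int i k X h hk := by
    have hX : cyl k X = X := not_not.mp hk
    ext s
    simp only [mem_cyl_weak, mem_int_weak, weakUpdate_of_ne h.symm]
    have : ∀ a, {b | weakUpdate (weakUpdate s k a) i b ∈ X} = {b | weakUpdate s i b ∈ X} := by
      intro a
      ext b
      rw [Set.mem_ofPred_eq, weakUpdate_comm h, weakUpdate_mem_iff_of_cyl_eq hX]
      rfl
    simp only [this]
    exact ⟨fun ⟨_, h⟩ => h, fun h => ⟨s.1 k, h⟩⟩
  subst_int i j X hj := by
    have hX : cyl j X = X := not_not.mp hj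
    by_cases h : i = j
    · subst h
      have hd : (diag i i : Set (weakSpace p)) = ⊤ := Set.eq_univ_of_forall fun _ => rfl
      rw [subst, subst, hd, top_inf_eq, top_inf_eq, hX, int_weak_of_cyl_eq hX, hX]
    · ext s
      rw [mem_subst_weak h, mem_int_weak, mem_int_weak, weakUpdate_self]
      have : {a | weakUpdate (weakUpdate s i (s.1 j)) i a ∈ X} =
          {a | weakUpdate s j a ∈ subst i j X} := by
        ext a
        rw [Set.mem_ofPred_eq, Set.mem_ofPred_eq, mem_subst_weak h, weakUpdate_idem,
          weakUpdate_self, weakUpdate_comm (Ne.symm h), weakUpdate_mem_iff_of_cyl_eq hX]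
      rw [this]

end WeakSpace

theorem notMem_dimSet_apply {J I : Type*} {C : I → Type*} [∀ i, TopCylOps J (C i)] {k : J}
    {x : ∀ i, C i} (h : k ∉ dimSet J x) (i : I) : k ∉ dimSet J (x i) :=
  not_not_intro (congrFun (not_not.mp h) i)

instance pi_topCylindricAlgebra {J I : Type*} (C : I → Type*) [∀ i, BooleanAlgebra (C i)]
    [∀ i, TopCylOps J (C i)] [∀ i, TopCylindricAlgebra J (C i)] :
    TopCylindricAlgebra J (∀ i, C i) where
  cyl_bot k := funext fun _ => cyl_bot k
  le_cyl k x i := le_cyl k (x i)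
  cyl_inf_cyl k x y := funext fun i => cyl_inf_cyl k (x i) (y i)
  cyl_comm j k x := funext fun i => cyl_comm j k (x i)
  diag_self j := funext fun _ => diag_self j
  diag_eq j k l hj hk := funext fun _ => diag_eq j k l hj hk
  cyl_diag_disjoint j k x h := funext fun i => cyl_diag_disjoint j k (x i) h
  univ_le_univ_int k x y i := univ_le_univ_int k (x i) (y i)
  int_le k x i := int_le k (x i)
  int_inf k x y := funext fun i => int_inf k (x i) (y i)
  int_le_int_int k x i := int_le_int_int k (x i)
  int_top k := funext fun _ => int_top k
  cyl_int j k x h hk := funext fun i => cyl_int j k (x i) h (notMem_dimSet_apply hk i)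
  subst_int j k x hk := funext fun i => subst_int j k (x i) (notMem_dimSet_apply hk i)

/-! ### Weak spaces of larger dimension -/

section Cylinder

variable {J K U : Type*} (e : J ↪ K) {p : J → U} {p' : K → U} (hp : ∀ j, p' (e j) = p j)

/-- The restriction of a tuple to a smaller set of indices. -/
def weakRestrict (s : weakSpace p') : weakSpace p :=
  ⟨fun j => s.1 (e j), fun _ => trivial,
    (s.2.2.preimage e.injective.injOn).subset fun j hj => by simpa [hp] using hj⟩

theorem weakRestrict_surjective : Function.Surjective (weakRestrict e hp) := by
  intro t
  refine ⟨⟨Function.extend e t.1 p', fun _ => trivial, ?_⟩, Subtype.ext (funext fun j => ?_)⟩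
  · refine (t.2.2.image e).subset fun k hk => ?_
    by_cases h : ∃ j, e j = k
    · obtain ⟨j, rfl⟩ := h
      refine ⟨j, ?_, rfl⟩
      simpa [e.injective.extend_apply, hp] using hk
    · exact absurd (Function.extend_apply' _ _ _ h) hk
  · exact e.injective.extend_apply _ _ _

theorem weakRestrict_update (s : weakSpace p') (j : J) (a : U) :
    weakRestrict e hp (weakUpdate s (e j) a) = weakUpdate (weakRestrict e hp s) j a := by
  refine Subtype.ext (funext fun i => ?_)
  by_cases h : i = j
  · subst h
    rw [weakUpdate_self]
    exact weakUpdate_self _ _ _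
  · rw [weakUpdate_of_ne h]
    exact weakUpdate_of_ne (fun h' => h (e.injective h')) _ _

theorem weakRestrict_update_of_notMem (s : weakSpace p') {k : K} (hk : k ∉ Set.range e) (a : U) :
    weakRestrict e hp (weakUpdate s k a) = weakRestrict e hp s :=
  Subtype.ext (funext fun j => weakUpdate_of_ne (fun h => hk ⟨j, h⟩) _ _)

variable [TopologicalSpace U]

theorem cyl_preimage_weakRestrict (j : J) (X : Set (weakSpace p)) :
    weakRestrict e hp ⁻¹' cyl j X = cyl (e j) (weakRestrict e hp ⁻¹' X) := by
  ext s
  simp only [Set.mem_preimage, mem_cyl_weak, weakRestrict_update]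

theorem int_preimage_weakRestrict (j : J) (X : Set (weakSpace p)) :
    weakRestrict e hp ⁻¹' int j X = int (e j) (weakRestrict e hp ⁻¹' X) := by
  ext s
  simp only [Set.mem_preimage, mem_int_weak, weakRestrict_update]
  rfl

theorem dimSet_preimage_weakRestrict (X : Set (weakSpace p)) :
    dimSet K (weakRestrict e hp ⁻¹' X) ⊆ Set.range e := by
  intro k hk
  by_contra hke
  refine hk ?_
  ext s
  simp only [mem_cyl_weak, Set.mem_preimage, weakRestrict_update_of_notMem e hp s hke]
  exact ⟨fun ⟨_, h⟩ => h, fun h => ⟨s.1 k, h⟩⟩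

end Cylinder

/-- A representable algebra is neatly embedded in the product of the full weak set algebras of any
larger dimension over the same spaces. -/
theorem TopRepresentable.exists_neatReduct_embedding {J K A : Type u} [BooleanAlgebra A]
    [TopCylOps J A] (h : TopRepresentable J A) (e : J ↪ K) :
    ∃ (B : Type u) (_ : BooleanAlgebra B) (_ : TopCylOps K B) (_ : TopCylindricAlgebra K B),
      Nonempty (TopCylEmbedding J A (neatReduct e B)) := by
  obtain ⟨I, U, hU, hT, p, ⟨φ⟩⟩ := h
  let p' : ∀ i, K → U i := fun i => Function.extend e (p i) fun _ => Classical.arbitrary _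
  have hp : ∀ i j, p' i (e j) = p i j := fun i j => e.injective.extend_apply _ _ _
  refine ⟨∀ i, Set (weakSpace (p' i)), inferInstance, inferInstance, inferInstance, ⟨?_⟩⟩
  exact
    { toFun := fun a => ⟨fun i => weakRestrict e (hp i) ⁻¹' φ.toFun a i, fun k hk => by
        by_contra hke
        refine hk (funext fun i => ?_)
        by_contra hi
        exact hke (dimSet_preimage_weakRestrict e (hp i) _ hi)⟩
      map_sup' := fun a b => Subtype.ext (funext fun i =>
        congrArg (weakRestrict e (hp i) ⁻¹' ·) (congrFun (φ.map_sup' a b) i))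
      map_inf' := fun a b => Subtype.ext (funext fun i =>
        congrArg (weakRestrict e (hp i) ⁻¹' ·) (congrFun (φ.map_inf' a b) i))
      map_top' := Subtype.ext (funext fun i =>
        congrArg (weakRestrict e (hp i) ⁻¹' ·) (congrFun φ.map_top' i))
      map_bot' := Subtype.ext (funext fun i =>
        congrArg (weakRestrict e (hp i) ⁻¹' ·) (congrFun φ.map_bot' i))
      map_cyl := fun j a => Subtype.ext (funext fun i =>
        (congrArg (weakRestrict e (hp i) ⁻¹' ·) (congrFun (φ.map_cyl j a) i)).trans
          (cyl_preimage_weakRestrict e (hp i) j _))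
      map_diag := fun j k => Subtype.ext (funext fun i =>
        congrArg (weakRestrict e (hp i) ⁻¹' ·) (congrFun (φ.map_diag j k) i))
      map_int := fun j a => Subtype.ext (funext fun i =>
        (congrArg (weakRestrict e (hp i) ⁻¹' ·) (congrFun (φ.map_int j a) i)).trans
          (int_preimage_weakRestrict e (hp i) j _))
      injective := fun a b hab => φ.injective (funext fun i =>
        (weakRestrict_surjective e (hp i)).preimage_injective
          (congrFun (congrArg Subtype.val hab) i)) }

/-! ### Disjoint unions of weak spaces -/

section Sigma

variable {J I : Type*} {U : I → Type*}

/-- A tuple in `U i` as a tuple in the disjoint union. -/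
def sigmaTuple (i : I) (t : J → U i) (j : J) : Σ i, U i := ⟨i, t j⟩

theorem sigmaTuple_inj [Nonempty J] {i i' : I} {t : J → U i} {t' : J → U i'}
    (h : sigmaTuple i t = sigmaTuple i' t') : i = i' ∧ HEq t t' := by
  obtain ⟨j⟩ := ‹Nonempty J›
  obtain rfl : i = i' := congrArg Sigma.fst (congrFun h j)
  refine ⟨rfl, heq_of_eq (funext fun k => ?_)⟩
  exact sigma_mk_injective (congrFun h k)

variable (p : ∀ i, J → U i)

/-- The generalized weak space whose components are the given weak spaces. -/
def sigmaWeakSpace : Set (J → Σ i, U i) :=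
  ⋃ i, weakSpaceOn (Set.range (Sigma.mk i)) (sigmaTuple i (p i))

variable {p}

theorem sigmaTuple_mem_weakSpaceOn {i : I} {t : J → U i} (ht : t ∈ weakSpace (p i)) :
    sigmaTuple i t ∈ weakSpaceOn (Set.range (Sigma.mk i)) (sigmaTuple i (p i)) :=
  ⟨fun j => ⟨t j, rfl⟩, ht.2.subset fun j hj h => hj (by simp only [sigmaTuple, h])⟩

theorem exists_sigmaTuple_of_mem {i : I} {s : J → Σ i, U i}
    (hs : s ∈ weakSpaceOn (Set.range (Sigma.mk i)) (sigmaTuple i (p i))) :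
    ∃ t ∈ weakSpace (p i), sigmaTuple i t = s := by
  choose t ht using hs.1
  obtain rfl : sigmaTuple i t = s := funext ht
  refine ⟨t, ⟨fun _ => trivial, hs.2.subset fun j hj h => hj (sigma_mk_injective h)⟩, rfl⟩

/-- The inclusion of a weak space into the generalized weak space. -/
def sigmaIncl (i : I) (t : weakSpace (p i)) : sigmaWeakSpace p :=
  ⟨sigmaTuple i t.1, Set.mem_iUnion.mpr ⟨i, sigmaTuple_mem_weakSpaceOn t.2⟩⟩

theorem exists_sigmaIncl (s : sigmaWeakSpace p) : ∃ i t, sigmaIncl i t = s := by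
  obtain ⟨i, hi⟩ := Set.mem_iUnion.mp s.2
  obtain ⟨t, ht, hts⟩ := exists_sigmaTuple_of_mem hi
  exact ⟨i, ⟨t, ht⟩, Subtype.ext hts⟩

/-- The union of the images of the given subsets of the components. -/
def sigmaSet (X : ∀ i, Set (weakSpace (p i))) : Set (sigmaWeakSpace p) :=
  {s | ∃ i, ∃ t ∈ X i, sigmaIncl i t = s}

theorem sigmaIncl_mem_sigmaSet [Nonempty J] {X : ∀ i, Set (weakSpace (p i))} {i : I}
    {t : weakSpace (p i)} : sigmaIncl i t ∈ sigmaSet X ↔ t ∈ X i := by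
  constructor
  · rintro ⟨i', t', ht', h⟩
    obtain ⟨rfl, h'⟩ := sigmaTuple_inj (congrArg Subtype.val h)
    rwa [← Subtype.ext (eq_of_heq h')]
  · exact fun h => ⟨i, t, h, rfl⟩

theorem eq_sigmaSet_of_forall [Nonempty J] {X : ∀ i, Set (weakSpace (p i))}
    {Y : Set (sigmaWeakSpace p)} (h : ∀ i (t : weakSpace (p i)), sigmaIncl i t ∈ Y ↔ t ∈ X i) :
    sigmaSet X = Y := by
  ext s
  obtain ⟨i, t, rfl⟩ := exists_sigmaIncl s
  rw [sigmaIncl_mem_sigmaSet, h]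

variable [∀ i, TopologicalSpace (U i)]

theorem sigmaSet_cyl [Nontrivial J] (k : J) (X : ∀ i, Set (weakSpace (p i))) :
    sigmaSet (cyl k X) = cyl k (sigmaSet X) := by
  refine eq_sigmaSet_of_forall fun i t => ?_
  constructor
  · rintro ⟨_, ⟨i', t', ht', rfl⟩, h⟩
    -- A coordinate other than `k` shows that both tuples lie in the same component.
    obtain ⟨j, hj⟩ := exists_ne k
    obtain rfl : i' = i := congrArg Sigma.fst (h j hj)
    exact ⟨t', ht', fun j hj => sigma_mk_injective (h j hj)⟩
  · rintro ⟨t', ht', h⟩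
    exact ⟨_, ⟨i, t', ht', rfl⟩, fun j hj => congrArg (Sigma.mk i) (h j hj)⟩

theorem sigmaSet_int [Nonempty J] (k : J) (X : ∀ i, Set (weakSpace (p i))) :
    sigmaSet (int k X) = int k (sigmaSet X) := by
  classical
  refine eq_sigmaSet_of_forall fun i t => ?_
  have h : Sigma.mk i ⁻¹' {a | Function.update (sigmaIncl i t).1 k a ∈
      Subtype.val '' sigmaSet X} = {a | weakUpdate t k a ∈ X i} := by
    ext a
    have hu : Function.update (sigmaIncl i t).1 k ⟨i, a⟩ = (sigmaIncl i (weakUpdate t k a)).1 := by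
      funext j
      by_cases hj : j = k
      · subst hj
        rw [Function.update_self]
        exact congrArg (Sigma.mk i) (weakUpdate_self t j a).symm
      · rw [Function.update_of_ne hj]
        exact congrArg (Sigma.mk i) (weakUpdate_of_ne hj t a).symm
    rw [Set.mem_preimage, Set.mem_ofPred_eq, hu, Subtype.val_injective.mem_set_image,
      sigmaIncl_mem_sigmaSet]
    rfl
  rw [mem_int_setAlgebra]
  change (sigmaIncl i t).1 k ∈ _ ↔ t ∈ int k (X i)
  rw [mem_int_weak, ← h, ← isOpenMap_sigmaMk.preimage_interior_eq_interior_preimage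
    continuous_sigmaMk]
  rfl

end Sigma

theorem TopRepresentable.isoTopGenWeakSetAlgebra {J A : Type u} [Nontrivial J] [BooleanAlgebra A]
    [TopCylOps J A] (h : TopRepresentable J A) : IsoTopGenWeakSetAlgebra J A := by
  obtain ⟨I, U, hU, hT, p, ⟨φ⟩⟩ := h
  refine ⟨Σ i, U i, inferInstance, sigmaWeakSpace p, ?_, ⟨?_⟩⟩
  · refine ⟨I, fun i => Set.range (Sigma.mk i), fun i => sigmaTuple i (p i),
      fun i => Set.range_nonempty _, fun i j => ⟨_, rfl⟩, ?_, ?_, rfl⟩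
    · exact Set.eq_univ_of_forall fun ⟨i, a⟩ => Set.mem_iUnion.mpr ⟨i, a, rfl⟩
    · intro i i' hne
      refine Set.disjoint_left.mpr fun s hs hs' => hne ?_
      obtain ⟨j⟩ := (inferInstance : Nonempty J)
      obtain ⟨a, ha⟩ := hs.1 j
      obtain ⟨b, hb⟩ := hs'.1 j
      exact congrArg Sigma.fst (ha.trans hb.symm)
  · exact
      { toFun := fun a => sigmaSet (φ.toFun a)
        map_sup' := fun a b => (congrArg sigmaSet (φ.map_sup' a b)).trans
          (eq_sigmaSet_of_forall fun _ _ =>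
            or_congr sigmaIncl_mem_sigmaSet sigmaIncl_mem_sigmaSet)
        map_inf' := fun a b => (congrArg sigmaSet (φ.map_inf' a b)).trans
          (eq_sigmaSet_of_forall fun _ _ =>
            and_congr sigmaIncl_mem_sigmaSet sigmaIncl_mem_sigmaSet)
        map_top' := (congrArg sigmaSet φ.map_top').trans
          (eq_sigmaSet_of_forall fun _ _ => Iff.rfl)
        map_bot' := (congrArg sigmaSet φ.map_bot').trans
          (eq_sigmaSet_of_forall fun _ _ => Iff.rfl)
        map_cyl := fun k a => (congrArg sigmaSet (φ.map_cyl k a)).trans (sigmaSet_cyl k _)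
        map_diag := fun j k => (congrArg sigmaSet (φ.map_diag j k)).trans
          (eq_sigmaSet_of_forall fun i t =>
            ⟨fun h => sigma_mk_injective h, fun h => congrArg (Sigma.mk i) h⟩)
        map_int := fun k a => (congrArg sigmaSet (φ.map_int k a)).trans (sigmaSet_int k _)
        injective := fun a b hab => φ.injective (funext fun i => Set.ext fun t => by
          rw [← sigmaIncl_mem_sigmaSet (X := φ.toFun a), ← sigmaIncl_mem_sigmaSet (X := φ.toFun b)]
          exact Set.ext_iff.mp hab _) }

/-! ### Components of generalized weak spaces -/

/-- Distinct components of a generalized weak space contain no two tuples that differ in only one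
coordinate: if `u` is a common coordinate, then the tuple which takes the common values of the base
points, and the value `u` elsewhere, lies in both components. -/
theorem component_unique {J U I : Type*} [Nontrivial J] {W : I → Set U} {p : I → J → U}
    (hp : ∀ i j, p i j ∈ W i)
    (hd : Pairwise fun i i' => Disjoint (weakSpaceOn (W i) (p i)) (weakSpaceOn (W i') (p i')))
    {i i' : I} {s s' : J → U} (hs : s ∈ weakSpaceOn (W i) (p i))
    (hs' : s' ∈ weakSpaceOn (W i') (p i')) {k : J} (h : ∀ j, j ≠ k → s j = s' j) : i = i' := by
  classical
  by_contra hne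
  obtain ⟨l, hl⟩ := exists_ne k
  have hfin : {j | p i j ≠ p i' j}.Finite := by
    refine ((hs.2.union hs'.2).insert k).subset fun j hj => ?_
    by_contra hj'
    simp only [Set.mem_insert_iff, Set.mem_union, Set.mem_ofPred_eq, not_or, not_not] at hj'
    exact hj (hj'.2.1.symm.trans ((h j hj'.1).trans hj'.2.2))
  have hdis := Set.disjoint_left.mp (hd hne)
  refine @hdis (fun j => if p i j = p i' j then p i j else s l) ⟨fun j => ?_, ?_⟩
    ⟨fun j => ?_, ?_⟩
  · dsimp only
    split_ifs
    · exact hp i j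
    · exact hs.1 l
  · refine hfin.subset fun j hj hj' => hj ?_
    exact if_pos hj'
  · dsimp only
    split_ifs with hj
    · exact hj ▸ hp i' j
    · exact h l hl ▸ hs'.1 l
  · refine hfin.subset fun j hj hj' => hj ?_
    exact (if_pos hj').trans hj'

section Component

variable {J U I : Type*} {W : I → Set U} {p : I → J → U}

/-- The base point of a component, as a tuple in its subbase. -/
def componentBase (hp : ∀ i j, p i j ∈ W i) (i : I) (j : J) : W i := ⟨p i j, hp i j⟩

/-- The inclusion of a component, regarded as a full weak space over its subbase. -/
def componentIncl (hp : ∀ i j, p i j ∈ W i) (i : I) (t : weakSpace (componentBase hp i)) :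
    (⋃ i, weakSpaceOn (W i) (p i) : Set (J → U)) :=
  ⟨fun j => t.1 j, Set.mem_iUnion.mpr
    ⟨i, fun j => (t.1 j).2, t.2.2.subset fun _ hj h => hj (congrArg Subtype.val h)⟩⟩

theorem componentIncl_mem (hp : ∀ i j, p i j ∈ W i) (i : I)
    (t : weakSpace (componentBase hp i)) :
    (componentIncl hp i t).1 ∈ weakSpaceOn (W i) (p i) :=
  ⟨fun j => (t.1 j).2, t.2.2.subset fun _ hj h => hj (congrArg Subtype.val h)⟩

theorem exists_componentIncl_of_mem (hp : ∀ i j, p i j ∈ W i) {i : I}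
    (s : (⋃ i, weakSpaceOn (W i) (p i) : Set (J → U))) (hs : s.1 ∈ weakSpaceOn (W i) (p i)) :
    ∃ t, componentIncl hp i t = s :=
  ⟨⟨fun j => ⟨s.1 j, hs.1 j⟩, fun _ => trivial,
    hs.2.subset fun _ hj h => hj (Subtype.ext h)⟩, rfl⟩

theorem exists_componentIncl (hp : ∀ i j, p i j ∈ W i)
    (s : (⋃ i, weakSpaceOn (W i) (p i) : Set (J → U))) : ∃ i t, componentIncl hp i t = s := by
  obtain ⟨i, hi⟩ := Set.mem_iUnion.mp s.2
  exact ⟨i, exists_componentIncl_of_mem hp s hi⟩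

theorem update_componentIncl [DecidableEq J] (hp : ∀ i j, p i j ∈ W i) (i : I)
    (t : weakSpace (componentBase hp i)) (k : J) (a : W i) :
    Function.update (componentIncl hp i t).1 k a = (componentIncl hp i (weakUpdate t k a)).1 := by
  funext j
  by_cases hj : j = k
  · subst hj
    rw [Function.update_self]
    exact congrArg Subtype.val (weakUpdate_self t j a).symm
  · rw [Function.update_of_ne hj]
    exact congrArg Subtype.val (weakUpdate_of_ne hj t a).symm

variable [TopologicalSpace U]

theorem preimage_componentIncl_cyl [Nontrivial J] (hp : ∀ i j, p i j ∈ W i)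
    (hd : Pairwise fun i i' => Disjoint (weakSpaceOn (W i) (p i)) (weakSpaceOn (W i') (p i')))
    (i : I) (k : J) (X : Set (⋃ i, weakSpaceOn (W i) (p i) : Set (J → U))) :
    componentIncl hp i ⁻¹' cyl k X = cyl k (componentIncl hp i ⁻¹' X) := by
  ext t
  constructor
  · rintro ⟨s, hs, hst⟩
    obtain ⟨i', hi'⟩ := Set.mem_iUnion.mp s.2
    obtain rfl := component_unique hp hd hi' (componentIncl_mem hp i t) hst
    obtain ⟨t', rfl⟩ := exists_componentIncl_of_mem hp s hi'
    exact ⟨t', hs, fun j hj => Subtype.ext (hst j hj)⟩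
  · rintro ⟨t', ht', h⟩
    exact ⟨_, ht', fun j hj => congrArg Subtype.val (h j hj)⟩

theorem preimage_componentIncl_int (hp : ∀ i j, p i j ∈ W i) {i : I} (hW : IsOpen (W i)) (k : J)
    (X : Set (⋃ i, weakSpaceOn (W i) (p i) : Set (J → U))) :
    componentIncl hp i ⁻¹' int k X = int k (componentIncl hp i ⁻¹' X) := by
  classical
  ext t
  have h : Subtype.val ⁻¹' {a | Function.update (componentIncl hp i t).1 k a ∈
      Subtype.val '' X} = {a | weakUpdate t k a ∈ componentIncl hp i ⁻¹' X} := by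
    ext a
    rw [Set.mem_preimage, Set.mem_ofPred_eq, update_componentIncl,
      Subtype.val_injective.mem_set_image]
    rfl
  rw [Set.mem_preimage, mem_int_setAlgebra, mem_int_weak, ← h,
    ← hW.isOpenMap_subtype_val.preimage_interior_eq_interior_preimage continuous_subtype_val]
  rfl

/-- The law `I_k 1 = 1` forces the subbases to be open. -/
theorem isOpen_of_int_top [Nontrivial J] (hp : ∀ i j, p i j ∈ W i)
    (hd : Pairwise fun i i' => Disjoint (weakSpaceOn (W i) (p i)) (weakSpaceOn (W i') (p i')))
    {k : J} (h : int k (⊤ : Set (⋃ i, weakSpaceOn (W i) (p i) : Set (J → U))) = ⊤) (i : I) :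
    IsOpen (W i) := by
  classical
  rw [← subset_interior_iff_isOpen]
  intro a ha
  let t : weakSpace (componentBase hp i) := ⟨componentBase hp i, fun _ => trivial, by simp⟩
  have hs : componentIncl hp i (weakUpdate t k ⟨a, ha⟩) ∈
      int k (⊤ : Set (⋃ i, weakSpaceOn (W i) (p i) : Set (J → U))) := by
    rw [h]
    trivial
  rw [mem_int_setAlgebra, ← update_componentIncl, Function.update_self] at hs
  refine interior_mono (fun b hb => ?_) hs
  obtain ⟨s, -, hsb⟩ := hb
  obtain ⟨i', hi'⟩ := Set.mem_iUnion.mp s.2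
  rw [Function.update_idem] at hsb
  obtain rfl := component_unique hp hd hi' (componentIncl_mem hp i t) (k := k) fun j hj => by
    rw [hsb, Function.update_of_ne hj]
  have := hi'.1 k
  rwa [hsb, Function.update_self] at this

end Component

theorem IsoTopGenWeakSetAlgebra.topRepresentable {J A : Type u} [Nontrivial J] [BooleanAlgebra A]
    [TopCylOps J A] [TopCylindricAlgebra J A] (h : IsoTopGenWeakSetAlgebra J A) :
    TopRepresentable J A := by
  obtain ⟨U, hU, V, ⟨I, W, p, hW, hp, -, hd, rfl⟩, ⟨φ⟩⟩ := h
  have hopen : ∀ i, IsOpen (W i) := by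
    obtain ⟨k⟩ := (inferInstance : Nonempty J)
    refine isOpen_of_int_top hp hd (k := k) ?_
    have h1 := φ.map_int k ⊤
    have h2 : φ.toFun ⊤ = ⊤ := φ.map_top'
    rw [int_top, h2] at h1
    exact h1.symm
  refine ⟨I, fun i => W i, fun i => (hW i).to_subtype, fun i => inferInstance,
    componentBase hp, ⟨?_⟩⟩
  exact
    { toFun := fun a i => componentIncl hp i ⁻¹' φ.toFun a
      map_sup' := fun a b => funext fun i => congrArg (componentIncl hp i ⁻¹' ·) (φ.map_sup' a b)
      map_inf' := fun a b => funext fun i => congrArg (componentIncl hp i ⁻¹' ·) (φ.map_inf' a b)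
      map_top' := funext fun i => congrArg (componentIncl hp i ⁻¹' ·) φ.map_top'
      map_bot' := funext fun i => congrArg (componentIncl hp i ⁻¹' ·) φ.map_bot'
      map_cyl := fun k a => funext fun i =>
        (congrArg (componentIncl hp i ⁻¹' ·) (φ.map_cyl k a)).trans
          (preimage_componentIncl_cyl hp hd i k _)
      map_diag := fun j k => funext fun i =>
        (congrArg (componentIncl hp i ⁻¹' ·) (φ.map_diag j k)).trans
          (Set.ext fun t => Subtype.ext_iff.symm)
      map_int := fun k a => funext fun i =>
        (congrArg (componentIncl hp i ⁻¹' ·) (φ.map_int k a)).trans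
          (preimage_componentIncl_int hp (hopen i) k _)
      injective := fun a b hab => φ.injective (Set.ext fun s => by
        obtain ⟨i, t, rfl⟩ := exists_componentIncl hp s
        exact Set.ext_iff.mp (congrFun hab i) t) }

/-! ### Representability and neat embeddings -/

theorem MemSNrTCA.topRepresentable {α : Ordinal.{u}} {A : Type u} [BooleanAlgebra A]
    [TopCylOps α.ToType A] (h : MemSNrTCA (le_self_add : α ≤ α + Ordinal.omega0) A) :
    TopRepresentable α.ToType A := by
  obtain ⟨B, _, _, _, ⟨φ⟩⟩ := h
  -- The spare indices are the ordinals `α + m` with `m` finite.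
  let n : ℕ ↪ (α + Ordinal.omega0).ToType :=
    { toFun := fun m => Ordinal.ToType.mk ⟨α + m, by simp⟩
      inj' := fun m m' h => by simpa using h }
  have hn : ∀ j m, n m ≠ ordinalInclusion (le_self_add : α ≤ α + Ordinal.omega0) j := by
    intro j m h
    have h' := Ordinal.ToType.mk.injective h
    have h'' : α + (m : Ordinal.{u}) = (Ordinal.ToType.mk.symm j).1 := congrArg Subtype.val h'
    exact absurd (Ordinal.ToType.mk.symm j).2 (by
      rw [← h'']
      simp)
  obtain ⟨D, _, _, _, ⟨ψ⟩⟩ := exists_neatReduct_sum_embedding (HenkinTerm α.ToType A) _ n hn φ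
  exact topRepresentable_of_exists_hom fun a ha => exists_hom_ne_bot ψ ha

theorem mainTheorem10 (α : Ordinal.{u}) (A : Type u) [BooleanAlgebra A] [TopCylOps α.ToType A]
    [TopCylindricAlgebra α.ToType A] :
    (TopRepresentable α.ToType A ↔
      MemSNrTCA (le_self_add : α ≤ α + Ordinal.omega0) A) ∧
    (2 ≤ α →
      (IsoTopGenWeakSetAlgebra α.ToType A ↔
        MemSNrTCA (le_self_add : α ≤ α + Ordinal.omega0) A)) := by
  have main : TopRepresentable α.ToType A ↔
      MemSNrTCA (le_self_add : α ≤ α + Ordinal.omega0) A :=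
    ⟨fun h => h.exists_neatReduct_embedding _, fun h => h.topRepresentable⟩
  refine ⟨main, fun hα => ?_⟩
  have : Nontrivial α.ToType := by
    rw [← Cardinal.one_lt_iff_nontrivial, Cardinal.mk_toType]
    have h2 := Ordinal.card_le_card hα
    rw [Ordinal.card_ofNat] at h2
    exact lt_of_lt_of_le (by exact_mod_cast one_lt_two) h2
  rw [← main]
  exact ⟨fun h => h.topRepresentable, fun h => h.isoTopGenWeakSetAlgebra⟩
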